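/- Let $d\ge 1$, let $H$ be a symmetric positive definite $d\times d$ real matrix with eigenvalues $m=\lambda_1\le\dots\le\lambda_d=M$, let $b_1\in\mathbb{R}^d$, $c_1\in\mathbb{R}$, and $F(x)=\frac12x^THx-b_1^Tx+c_1$. Let $\gamma>0$, $\beta>0$, and let $(V(t),X(t))_{t\ge0}$ be a solution in $\mathbb{R}^d\times\mathbb{R}^d$ of the underdamped Langevin diffusion $$dV(t)=-\gamma V(t)\,dt-\nabla F(X(t))\,dt+\sqrt{2\gamma\beta^{-1}}\,dB_t,\qquad dX(t)=V(t)\,dt,$$ where $B$ is a standard $d$-dimensional Brownian motion independent of the initial condition $(V(0),X(0))$. Assume that $X(0)$ is deterministic and that either $V(0)=0$ or $V(0)$ has its equilibrium law $\mathcal{N}(0,\beta^{-1}I)$. Let $\pi_{t,\gamma}$ be the law of $X(t)$, let $\pi(dx)\propto e^{-\beta F(x)}dx$, and let $\mathcal{W}_2$ be the 2-Wasserstein distance for the Euclidean norm. Put $$\hat\varepsilon:=1-\frac{\gamma}{2\sqrt m},\qquad C_{\hat\varepsilon}:=\frac{1+M}{\sqrt{m(1-(1-\hat\varepsilon)^2)}},\qquad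 C_H:=\max_{i:\lambda_i>m}\frac{(1+\lambda_i)^2}{\lambda_i-m}$$ (with $C_H:=0$ if all eigenvalues equal $m$). Then: (i) If $\gamma<2\sqrt m$, then for every $t\ge0$, $\ \mathcal{W}_2(\pi_{t,\gamma},\pi)\le C_{\hat\varepsilon}\,e^{-\sqrt m(1-\hat\varepsilon)t}\,\mathcal{W}_2(\pi_{0,\gamma},\pi)$. (ii) If $\gamma=2\sqrt m$, then for every $t\ge0$, $\ \mathcal{W}_2(\pi_{t,\gamma},\pi)\le\sqrt{C_H+2+(m+1)^2t^2}\;e^{-\sqrt m\,t}\,\mathcal{W}_2(\pi_{0,\gamma},\pi)$. (iii) For any $\gamma>0$, $\ \mathcal{W}_2(\pi_{0,\gamma},\pi)\le\left(2\|X(0)\|^2+\frac4m\left(\frac{\|b_1\|^2}{2m}+\frac d\beta\right)\right)^{1/2}$. -/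

import Mathlib

open MeasureTheory ProbabilityTheory
open scoped NNReal ENNReal

namespace ULD

noncomputable section

/-- `ℝ^d` with the Euclidean norm. -/
abbrev E (d : ℕ) : Type := EuclideanSpace ℝ (Fin d)

/-- The quadratic function `F(x) = (1/2) xᵀ H x - b₁ᵀ x + c₁`. -/
def quadObjective {d : ℕ} (H : Matrix (Fin d) (Fin d) ℝ) (b₁ : E d) (c₁ : ℝ) (x : E d) : ℝ :=
  (1 / 2) * inner ℝ x (WithLp.toLp 2 (H.mulVec x.ofLp)) - inner ℝ b₁ x + c₁

/-- The probability measure on `ℝ^d` proportional to `exp(-β F(x)) dx`. -/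
def gibbs {d : ℕ} (β : ℝ) (F : E d → ℝ) : Measure (E d) :=
  (volume : Measure (E d)).tilted (fun x => -β * F x)

/-- The 2-Wasserstein distance, with values in `[0, ∞]`: the infimum of `(𝔼 ‖Y₁ - Y₂‖²)^(1/2)` over
all joint laws `ρ` of pairs `(Y₁, Y₂)` with marginals `μ` and `ν`. -/
def W2 {d : ℕ} (μ ν : Measure (E d)) : ℝ≥0∞ :=
  ⨅ (ρ : Measure (E d × E d)) (_ : ρ.fst = μ ∧ ρ.snd = ν),
    (∫⁻ p, ‖p.1 - p.2‖ₑ ^ 2 ∂ρ) ^ (1 / 2 : ℝ)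

/-- A standard `d`-dimensional Brownian motion: the coordinates are independent standard
one-dimensional Brownian motions. -/
structure IsStdBrownian {d : ℕ} {Ω : Type*} [MeasurableSpace Ω] (B : ℝ≥0 → Ω → E d)
    (P : Measure Ω) : Prop where
  measurable : ∀ t, Measurable (B t)
  brownian : ∀ i : Fin d, IsBrownianReal (fun t ω => B t ω i) P
  indep : iIndepFun (fun (i : Fin d) (ω : Ω) (t : ℝ≥0) => B t ω i) P

/-- `(V, X)` is a solution, driven by the standard Brownian motion `B`, of the underdamped Langevin
diffusion
`dV = -γ V dt - ∇F(X) dt + √(2γ/β) dB`, `dX = V dt`.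
As the noise is additive, the equation is the integral equation below. The initial condition is
independent of `B`. -/
structure IsUnderdampedLangevin {d : ℕ} {Ω : Type*} [MeasurableSpace Ω] (F : E d → ℝ) (γ β : ℝ)
    (P : Measure Ω) (B V X : ℝ≥0 → Ω → E d) : Prop where
  brownian : IsStdBrownian B P
  measurable_V : ∀ t, Measurable (V t)
  measurable_X : ∀ t, Measurable (X t)
  continuous_V : ∀ᵐ ω ∂P, Continuous (fun t => V t ω)
  continuous_X : ∀ᵐ ω ∂P, Continuous (fun t => X t ω)
  indep_initial : IndepFun (fun ω => (V 0 ω, X 0 ω)) (fun ω t => B t ω) P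
  eq_V : ∀ᵐ ω ∂P, ∀ t : ℝ≥0,
    V t ω = V 0 ω
      - (∫ s in (0 : ℝ)..t, (γ • V s.toNNReal ω + gradient F (X s.toNNReal ω)))
      + √(2 * γ * β⁻¹) • B t ω
  eq_X : ∀ᵐ ω ∂P, ∀ t : ℝ≥0,
    X t ω = X 0 ω + ∫ s in (0 : ℝ)..t, V s.toNNReal ω

section Constants

variable {d : ℕ} {H : Matrix (Fin d) (Fin d) ℝ}

/-- The smallest eigenvalue `m` of `H`. -/
def eigMin (hH : H.IsHermitian) : ℝ := ⨅ i, hH.eigenvalues i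

/-- The largest eigenvalue `M` of `H`. -/
def eigMax (hH : H.IsHermitian) : ℝ := ⨆ i, hH.eigenvalues i

/-- `ε̂ = 1 - γ / (2√m)`. -/
def epsHat (hH : H.IsHermitian) (γ : ℝ) : ℝ := 1 - γ / (2 * √(eigMin hH))

/-- `C_ε̂ = (1 + M) / √(m (1 - (1 - ε̂)²))`. -/
def constEps (hH : H.IsHermitian) (γ : ℝ) : ℝ :=
  (1 + eigMax hH) / √(eigMin hH * (1 - (1 - epsHat hH γ) ^ 2))

/-- `C_H = max_{i : λ_i > m} (1 + λ_i)² / (λ_i - m)`; it is `0` if all eigenvalues equal `m`. -/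
def constH (hH : H.IsHermitian) : ℝ :=
  ⨆ i : {i : Fin d // eigMin hH < hH.eigenvalues i},
    (1 + hH.eigenvalues i) ^ 2 / (hH.eigenvalues i - eigMin hH)

end Constants

end

end ULD

/-! In the eigenbasis of `H` the diffusion splits into damped oscillators `y'' + γ y' + l y =
noise`, one per eigenvalue `l`, each centred at its coordinate of the minimiser of `F`. Let `g` be
the impulse response and `A = g' + γ g`. A coordinate started at displacement `p` with velocity `q`
has displacement `A p + g q` at time `t`, plus a noise term independent of the initial data.

Couple `X` with a copy driven by the same Brownian path, whose position is drawn from the Gibbs law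
and whose velocity is drawn from `N(0, β⁻¹ I)`, independently of each other and of `X`. The copy
stays Gibbs distributed (`map_synchronous`): by `energy_identity`, the variance lost by damping is
exactly what the noise restores.

The noise cancels in the difference, whose coordinates are `A p + g q` up to sign. Here `p` and `q`
are independent and `q` has mean zero, so the mean square is `A² E p² + g² E q²`. Moreover `E q² ≤
2/β`, while `E p² ≥ 1/(β l)`; hence it is at most `(A² + 2 l g²) E p²`. As `X(0)` is deterministic,
`∑ E p²` is exactly the squared initial Wasserstein distance. This is `W2_le`; the rates follow from
explicit bounds on `A² + 2 l g²` in the underdamped and critical cases.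

Part (iii) is the exact second moment of the Gibbs law about `X(0)`, estimated coordinatewise. -/

namespace ULD

open Filter Set
open scoped Topology Matrix

/-! ### Damped oscillators and their impulse responses -/

/-- `g` is the response at rest of the damped oscillator `g'' + γ g' + l g = 0` to a unit impulse,
and `g'` is its derivative. -/
structure IsImpulseResponse (γ l : ℝ) (g g' : ℝ → ℝ) : Prop where
  zero : g 0 = 0
  deriv_zero : g' 0 = 1
  hasDerivAt : ∀ s, HasDerivAt g (g' s) s
  hasDerivAt_deriv : ∀ s, HasDerivAt g' (-γ * g' s - l * g s) s

namespace IsImpulseResponse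

variable {γ l : ℝ} {g g' : ℝ → ℝ}

lemma continuous (h : IsImpulseResponse γ l g g') : Continuous g :=
  continuous_iff_continuousAt.2 fun s => (h.hasDerivAt s).continuousAt

lemma continuous_deriv (h : IsImpulseResponse γ l g g') : Continuous g' :=
  continuous_iff_continuousAt.2 fun s => (h.hasDerivAt_deriv s).continuousAt

/-- Since `(g' + γ g)' = -l g`, the derivative of `(g' + γ g)² + l g²` is `-2γ l g²`, and its value
at `0` is `1`. This is the fluctuation-dissipation balance behind stationarity. -/
lemma energy_identity (h : IsImpulseResponse γ l g g') (t : ℝ) :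
    (g' t + γ * g t) ^ 2 + l * g t ^ 2 + 2 * γ * l * ∫ s in (0 : ℝ)..t, g (t - s) ^ 2 = 1 := by
  have hd : ∀ s ∈ uIcc 0 t, HasDerivAt (fun s => (g' s + γ * g s) ^ 2 + l * g s ^ 2)
      (-(2 * γ * l) * g s ^ 2) s := fun s _ => by
    have h1 := h.hasDerivAt s
    have h2 := h.hasDerivAt_deriv s
    refine HasDerivAt.congr_deriv
      (((h2.add (h1.const_mul γ)).pow 2).add ((h1.pow 2).const_mul l)) ?_
    simp
    ring
  have hc := h.continuous
  have := intervalIntegral.integral_eq_sub_of_hasDerivAt hd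
    (Continuous.intervalIntegrable (by fun_prop) _ _)
  rw [intervalIntegral.integral_const_mul, h.zero, h.deriv_zero] at this
  rw [intervalIntegral.integral_comp_sub_left (fun s => g s ^ 2) t]
  simp only [sub_self, sub_zero]
  linarith

/-- Variation of constants for the forced oscillator `x' = v`, `v' = -γ v - l x + σ w'`, where the
forcing `w` is merely continuous. -/
lemma duhamel (h : IsImpulseResponse γ l g g') {x v w : ℝ → ℝ} (hx : Continuous x)
    (hv : Continuous v) (hw : Continuous w) {σ t : ℝ} (ht : 0 ≤ t)
    (hxe : ∀ s ∈ Icc 0 t, x s = x 0 + ∫ r in (0 : ℝ)..s, v r)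
    (hve : ∀ s ∈ Icc 0 t, v s = v 0 - (∫ r in (0 : ℝ)..s, (γ * v r + l * x r)) + σ * w s) :
    x t = (g' t + γ * g t) * x 0 + g t * v 0 + σ * ∫ s in (0 : ℝ)..t, g' (t - s) * w s := by
  set X : ℝ → ℝ := fun s => x 0 + ∫ r in (0 : ℝ)..s, v r with hX
  set U : ℝ → ℝ := fun s => v 0 - ∫ r in (0 : ℝ)..s, (γ * v r + l * x r) with hU
  have dX : ∀ s, HasDerivAt X (v s) s := fun s =>
    (intervalIntegral.integral_hasDerivAt_right (hv.intervalIntegrable _ _)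
      (hv.stronglyMeasurableAtFilter _ _) hv.continuousAt).const_add _
  have hc : Continuous fun r => γ * v r + l * x r := by fun_prop
  have dU : ∀ s, HasDerivAt U (-(γ * v s + l * x s)) s := fun s =>
    (intervalIntegral.integral_hasDerivAt_right (hc.intervalIntegrable _ _)
      (hc.stronglyMeasurableAtFilter _ _) hc.continuousAt).const_sub _
  have dr : ∀ s, HasDerivAt (fun s => t - s) (-1) s := fun s => (hasDerivAt_id s).const_sub t
  have dg : ∀ s, HasDerivAt (fun s => g (t - s)) (-g' (t - s)) s := fun s => by
    exact HasDerivAt.congr_deriv ((h.hasDerivAt (t - s)).comp s (dr s)) (by ring)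
  have dg' : ∀ s, HasDerivAt (fun s => g' (t - s)) (γ * g' (t - s) + l * g (t - s)) s := fun s => by
    refine HasDerivAt.congr_deriv ((h.hasDerivAt_deriv (t - s)).comp s (dr s)) ?_
    ring
  -- `U` equals `v - σ w` on `[0, t]` and is differentiable although `w` need not be. Pairing `(X,
  -- U)` with the adjoint solution run backwards from `t` cancels everything but the forcing, and `g
  -- 0 = 0` removes `U` at the endpoint.
  have key : ∀ s ∈ uIcc 0 t, HasDerivAt
      (fun s => g (t - s) * U s + (g' (t - s) + γ * g (t - s)) * X s)
      (σ * (g' (t - s) * w s)) s := fun s hs => by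
    rw [uIcc_of_le ht] at hs
    have e1 : X s = x s := (hxe s hs).symm
    have e2 : v s = U s + σ * w s := hve s hs
    refine HasDerivAt.congr_deriv
      (((dg s).mul (dU s)).add (((dg' s).add ((dg s).const_mul γ)).mul (dX s))) ?_
    simp only [Pi.add_apply]
    rw [e1, e2]
    ring
  have hg' := h.continuous_deriv
  have := intervalIntegral.integral_eq_sub_of_hasDerivAt key
    (Continuous.intervalIntegrable (by fun_prop) _ _)
  rw [intervalIntegral.integral_const_mul] at this
  have e1 : X t = x t := (hxe t ⟨ht, le_rfl⟩).symm
  rw [this, sub_self, h.zero, h.deriv_zero, e1]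
  simp [hX, hU]
  ring

end IsImpulseResponse

lemma exp_half_sq (c t : ℝ) : Real.exp (-(c / 2) * t) ^ 2 = Real.exp (-c * t) := by
  rw [← Real.exp_nat_mul]
  congr 1
  push_cast
  ring

/-- With `w = √(l - γ²/4)`, the response is `exp(-γ t/2) sin(w t) / w`. -/
lemma exists_isImpulseResponse_of_underdamped {γ l : ℝ} (hl : γ ^ 2 / 4 < l) :
    ∃ g g' : ℝ → ℝ, IsImpulseResponse γ l g g' ∧ ∀ t,
      (g' t + γ * g t) ^ 2 + 2 * l * g t ^ 2 ≤ 4 * l / (l - γ ^ 2 / 4) * Real.exp (-γ * t) := by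
  obtain ⟨w, hw, hwl⟩ : ∃ w : ℝ, 0 < w ∧ w ^ 2 = l - γ ^ 2 / 4 :=
    ⟨√(l - γ ^ 2 / 4), Real.sqrt_pos.2 (by linarith), Real.sq_sqrt (by linarith)⟩
  have hde : ∀ s : ℝ, HasDerivAt (fun s => Real.exp (-(γ / 2) * s))
      (Real.exp (-(γ / 2) * s) * -(γ / 2)) s := fun s => by
    simpa using ((hasDerivAt_id s).const_mul (-(γ / 2))).exp
  have hds : ∀ s : ℝ, HasDerivAt (fun s => Real.sin (w * s)) (Real.cos (w * s) * w) s := fun s => by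
    simpa using ((hasDerivAt_id s).const_mul w).sin
  have hdc : ∀ s : ℝ, HasDerivAt (fun s => Real.cos (w * s)) (-Real.sin (w * s) * w) s := fun s => by
    simpa using ((hasDerivAt_id s).const_mul w).cos
  refine ⟨fun s => Real.exp (-(γ / 2) * s) * (Real.sin (w * s) / w),
    fun s => Real.exp (-(γ / 2) * s) * (Real.cos (w * s) - γ / (2 * w) * Real.sin (w * s)),
    ⟨by simp, by simp, fun s => ?_, fun s => ?_⟩, fun t => ?_⟩
  · refine HasDerivAt.congr_deriv ((hde s).mul ((hds s).div_const w)) ?_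
    field_simp
    ring
  · refine HasDerivAt.congr_deriv ((hde s).mul ((hdc s).sub ((hds s).const_mul (γ / (2 * w))))) ?_
    have : l = w ^ 2 + γ ^ 2 / 4 := by linarith
    rw [this]
    field_simp
    ring
  · have hsc := Real.sin_sq_add_cos_sq (w * t)
    simp only
    generalize Real.sin (w * t) = s at hsc ⊢
    generalize Real.cos (w * t) = c at hsc ⊢
    -- The first square is part of a sum of two squares equal to `l`, so `3 l` would do; `4 l` suits
    -- the later comparison `4 l ≤ (1 + l)²`.
    have h1 : (w * c + γ / 2 * s) ^ 2 + 2 * l * s ^ 2 ≤ 4 * l := by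
      have h2 : (w * c + γ / 2 * s) ^ 2 + (w * s - γ / 2 * c) ^ 2 = l := by
        linear_combination (w ^ 2 + γ ^ 2 / 4) * hsc + hwl
      have hl0 : 0 ≤ l := by nlinarith [sq_nonneg γ]
      have : 2 * l * s ^ 2 ≤ 2 * l * 1 :=
        mul_le_mul_of_nonneg_left (by nlinarith [sq_nonneg c]) (by linarith)
      nlinarith [sq_nonneg (w * s - γ / 2 * c)]
    rw [← exp_half_sq γ t, ← hwl]
    calc _ = ((w * c + γ / 2 * s) ^ 2 + 2 * l * s ^ 2) / w ^ 2 * Real.exp (-(γ / 2) * t) ^ 2 := by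
          field_simp
          ring
      _ ≤ _ := by gcongr

/-- The double root gives `exp(-γ t/2) t`. With `a = γ t/2` and `l t² = a²`, the bound reduces to
`(1 - a)² ≥ 0`. -/
lemma exists_isImpulseResponse_of_critical {γ l : ℝ} (hl : l = γ ^ 2 / 4) :
    ∃ g g' : ℝ → ℝ, IsImpulseResponse γ l g g' ∧ ∀ t,
      (g' t + γ * g t) ^ 2 + 2 * l * g t ^ 2 ≤ (2 + 4 * l * t ^ 2) * Real.exp (-γ * t) := by
  have hde : ∀ s : ℝ, HasDerivAt (fun s => Real.exp (-(γ / 2) * s))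
      (Real.exp (-(γ / 2) * s) * -(γ / 2)) s := fun s => by
    simpa using ((hasDerivAt_id s).const_mul (-(γ / 2))).exp
  refine ⟨fun s => Real.exp (-(γ / 2) * s) * s,
    fun s => Real.exp (-(γ / 2) * s) * (1 - γ / 2 * s),
    ⟨by simp, by simp, fun s => ?_, fun s => ?_⟩, fun t => ?_⟩
  · refine HasDerivAt.congr_deriv ((hde s).mul (hasDerivAt_id s)) ?_
    simp
    ring
  · refine HasDerivAt.congr_deriv ((hde s).mul (((hasDerivAt_id s).const_mul (γ / 2)).const_sub 1)) ?_
    simp [hl]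
    ring
  · rw [← exp_half_sq γ t]
    calc _ = ((1 + γ / 2 * t) ^ 2 + 2 * l * t ^ 2) * Real.exp (-(γ / 2) * t) ^ 2 := by ring
      _ ≤ _ := by
        refine mul_le_mul_of_nonneg_right ?_ (sq_nonneg _)
        rw [hl]
        nlinarith [sq_nonneg (1 - γ / 2 * t)]

/-! ### Riemann sums and the Wiener integral -/

/-- Only `f` is sampled, so uniform continuity of `f` and a bound on `k` suffice. Leaving the tags
`ξ` free allows both left and right endpoints. -/
lemma tendsto_sum_mul_integral {f k : ℝ → ℝ} {t : ℝ} (ht : 0 ≤ t) (hf : Continuous f)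
    (hk : Continuous k) (ξ : ℕ → ℕ → ℝ)
    (hξ : ∀ n i : ℕ, ξ n i ∈ Icc (i * (t / n) : ℝ) ((i + 1 : ℕ) * (t / n))) :
    Tendsto (fun n : ℕ => ∑ i ∈ Finset.range n,
      f (ξ n i) * ∫ s in (i * (t / n) : ℝ)..((i + 1 : ℕ) * (t / n)), k s) atTop
      (𝓝 (∫ s in (0 : ℝ)..t, f s * k s)) := by
  obtain ⟨K, hK⟩ := isCompact_Icc.exists_bound_of_continuousOn (hk.continuousOn (s := Icc 0 t))
  have hK0 : 0 ≤ K := (norm_nonneg _).trans (hK 0 ⟨le_rfl, ht⟩)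
  have hu := isCompact_Icc.uniformContinuousOn_of_continuous (hf.continuousOn (s := Icc 0 t))
  rw [Metric.uniformContinuousOn_iff_le] at hu
  rw [Metric.tendsto_atTop]
  intro ε hε
  -- The `+ 1` keeps the denominator positive when `K * t = 0` and makes the final inequality
  -- strict.
  obtain ⟨δ, hδ, hfδ⟩ := hu (ε / (K * t + 1)) (by positivity)
  have hlim : Tendsto (fun n : ℕ => t / n) atTop (𝓝 0) := tendsto_const_div_atTop_nhds_zero_nat t
  obtain ⟨N, hN⟩ := eventually_atTop.1 ((hlim.eventually (gt_mem_nhds hδ)).and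
    (eventually_ge_atTop 1))
  refine ⟨N, fun n hn => ?_⟩
  obtain ⟨hnδ, hn1⟩ := hN n hn
  have hn0 : (n : ℝ) ≠ 0 := by positivity
  have htn : 0 ≤ t / n := by positivity
  have hsum : ∑ i ∈ Finset.range n, ∫ s in ((i : ℕ) * (t / n) : ℝ)..((i + 1 : ℕ) * (t / n)),
      f s * k s = ∫ s in (0 : ℝ)..t, f s * k s := by
    rw [intervalIntegral.sum_integral_adjacent_intervals (a := fun i : ℕ => (i * (t / n) : ℝ))
      fun i _ => Continuous.intervalIntegrable (by fun_prop) _ _]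
    simp [mul_div_cancel₀ _ hn0]
  rw [Real.dist_eq, ← hsum, ← Finset.sum_sub_distrib]
  calc _ ≤ ∑ i ∈ Finset.range n, ε / (K * t + 1) * K * (t / n) := by
        refine (Finset.abs_sum_le_sum_abs _ _).trans (Finset.sum_le_sum fun i hi => ?_)
        rw [← intervalIntegral.integral_const_mul, ← intervalIntegral.integral_sub
          (Continuous.intervalIntegrable (by fun_prop) _ _)
          (Continuous.intervalIntegrable (by fun_prop) _ _)]
        have hle : (i * (t / n) : ℝ) ≤ (i + 1 : ℕ) * (t / n) := by
          push_cast; nlinarith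
        have hsub : Icc (i * (t / n) : ℝ) ((i + 1 : ℕ) * (t / n)) ⊆ Icc 0 t := by
          refine Icc_subset_Icc (by positivity) ?_
          have : ((i + 1 : ℕ) : ℝ) ≤ n := by exact_mod_cast Finset.mem_range.1 hi
          calc _ ≤ (n : ℝ) * (t / n) := by gcongr
            _ = t := mul_div_cancel₀ _ hn0
        refine (Real.norm_eq_abs _).symm.trans_le <|
          (intervalIntegral.norm_integral_le_of_norm_le_const (C := ε / (K * t + 1) * K)
          fun s hs => ?_).trans_eq ?_
        · rw [uIoc_of_le hle] at hs
          have hs' := Ioc_subset_Icc_self hs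
          rw [← sub_mul, norm_mul]
          refine mul_le_mul ?_ (hK s (hsub hs')) (norm_nonneg _) (by positivity)
          have h3 := hξ n i
          refine (Real.norm_eq_abs _).trans_le (hfδ _ (hsub h3) _ (hsub hs') ?_)
          rw [Real.dist_eq, abs_le]
          push_cast at h3 hs'
          constructor <;> linarith [h3.1, h3.2, hs'.1, hs'.2]
        · rw [abs_of_nonneg (by linarith)]
          push_cast
          ring
    _ = ε * (K * t / (K * t + 1)) := by
        rw [Finset.sum_const, Finset.card_range, nsmul_eq_mul]
        field_simp
    _ < ε := by
        have : 0 ≤ K * t := by positivity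
        have : K * t / (K * t + 1) < 1 := by rw [div_lt_one (by positivity)]; linarith
        nlinarith

/-- Integration by parts for the Riemann–Stieltjes sums of `∫ h dw`, with vanishing boundary
terms. -/
lemma tendsto_sum_mul_sub {h h' w : ℝ → ℝ} {t : ℝ} (ht : 0 ≤ t)
    (hh : ∀ s, HasDerivAt h (h' s) s) (hh' : Continuous h') (hw : Continuous w) (hw0 : w 0 = 0)
    (hht : h t = 0) :
    Tendsto (fun n : ℕ => ∑ i ∈ Finset.range n,
      h (i * (t / n)) * (w ((i + 1 : ℕ) * (t / n)) - w (i * (t / n)))) atTop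
      (𝓝 (-∫ s in (0 : ℝ)..t, w s * h' s)) := by
  -- Summation by parts moves the difference onto `h` and leaves `w` at the right endpoint of each
  -- cell.
  have hlim := (tendsto_sum_mul_integral ht hw hh' (fun n i : ℕ => ((i + 1 : ℕ) : ℝ) * (t / n))
    fun n i => ⟨by push_cast; nlinarith [div_nonneg ht (Nat.cast_nonneg (α := ℝ) n)], le_rfl⟩).neg
  refine hlim.congr' ?_
  filter_upwards [eventually_ge_atTop 1] with n hn
  have hn0 : (n : ℝ) ≠ 0 := by positivity
  have htel := Finset.sum_range_sub (fun i : ℕ => h (i * (t / n)) * w (i * (t / n))) n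
  rw [mul_div_cancel₀ _ hn0, hht] at htel
  simp only [Nat.cast_zero, zero_mul, hw0, mul_zero, sub_zero] at htel
  rw [← sub_eq_zero, ← neg_eq_zero, ← htel, ← Finset.sum_neg_distrib, ← Finset.sum_sub_distrib,
    ← Finset.sum_neg_distrib]
  refine Finset.sum_congr rfl fun i _ => ?_
  rw [intervalIntegral.integral_eq_sub_of_hasDerivAt (fun s _ => hh s)
    (hh'.intervalIntegrable _ _)]
  ring

lemma charFun_map_apply_one {Ω : Type*} [MeasurableSpace Ω] {P : Measure Ω} {Y : Ω → ℝ}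
    (hY : AEMeasurable Y P) :
    charFun (P.map Y) 1 = ∫ ω, Complex.exp (Y ω * Complex.I) ∂P := by
  rw [charFun_apply_real, integral_map hY (by fun_prop)]
  simp

/-- Independent Gaussian increments make the characteristic function a product. The value at `1`
suffices, since frequencies can be absorbed into `c`. -/
lemma charFun_sum_increments {Ω : Type*} [MeasurableSpace Ω] {P : Measure Ω} {W : ℝ≥0 → Ω → ℝ}
    (hW : IsPreBrownianReal W P) {τ : ℕ → ℝ≥0} (hτ : Monotone τ) (c : ℕ → ℝ) (n : ℕ) :
    charFun (P.map fun ω => ∑ k ∈ Finset.range n, c k * (W (τ (k + 1)) ω - W (τ k) ω)) 1 =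
      Complex.exp ((-(∑ k ∈ Finset.range n, c k ^ 2 * ((τ (k + 1) : ℝ) - τ k)) / 2 : ℝ)) := by
  have hm : ∀ k, AEMeasurable (fun ω => W (τ (k + 1)) ω - W (τ k) ω) P := fun k =>
    (hW.aemeasurable _).sub (hW.aemeasurable _)
  have hind : iIndepFun (fun k ω => c k * (W (τ (k + 1)) ω - W (τ k) ω)) P :=
    (hW.hasIndepIncrements.nat hτ).comp (fun k x => c k * x) fun k => by fun_prop
  rw [(hind.precomp Subtype.val_injective).charFun_map_fun_finsetSum_eq_prod
    fun k _ => (hm k).const_mul _]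
  rw [Finset.prod_apply]
  simp_rw [neg_div, Finset.sum_div, ← Finset.sum_neg_distrib, Complex.ofReal_sum, Complex.exp_sum]
  refine Finset.prod_congr rfl fun k _ => ?_
  have hlaw : P.map (fun ω => W (τ (k + 1)) ω - W (τ k) ω) = _ := (hW.hasLaw_sub _ _).map_eq
  have hcomp := AEMeasurable.map_map_of_aemeasurable (μ := P) (g := fun x : ℝ => c k * x)
    (by fun_prop) (hm k)
  rw [show (fun ω => c k * (W (τ (k + 1)) ω - W (τ k) ω)) =
    (fun x : ℝ => c k * x) ∘ fun ω => W (τ (k + 1)) ω - W (τ k) ω from rfl, ← hcomp,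
    charFun_map_mul, hlaw, charFun_gaussianReal]
  have hnd : ((nndist (τ (k + 1)).1 (τ k).1 : ℝ≥0) : ℝ) = (τ (k + 1) : ℝ) - τ k := by
    rw [coe_nndist, Real.dist_eq]
    exact abs_of_nonneg (sub_nonneg.2 (hτ k.le_succ))
  congr 1
  simp only [hnd]
  push_cast
  ring

lemma IsStdBrownian.charFun_sum_increments {d : ℕ} {Ω : Type*} [MeasurableSpace Ω] {P : Measure Ω}
    {B : ℝ≥0 → Ω → E d} (hB : IsStdBrownian B P) {τ : ℕ → ℝ≥0} (hτ : Monotone τ)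
    (c : Fin d → ℕ → ℝ) (n : ℕ) :
    charFun (P.map fun ω => ∑ j, ∑ k ∈ Finset.range n, c j k * (B (τ (k + 1)) ω j - B (τ k) ω j)) 1 =
      Complex.exp
        ((-(∑ j, ∑ k ∈ Finset.range n, c j k ^ 2 * ((τ (k + 1) : ℝ) - τ k)) / 2 : ℝ)) := by
  have hm := hB.measurable
  have hind : iIndepFun (fun j ω => ∑ k ∈ Finset.range n, c j k * (B (τ (k + 1)) ω j - B (τ k) ω j))
      P :=
    hB.indep.comp (fun j p => ∑ k ∈ Finset.range n, c j k * (p (τ (k + 1)) - p (τ k)))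
      fun j => by fun_prop
  rw [hind.charFun_map_fun_sum_eq_prod fun j => by fun_prop, Finset.prod_apply]
  simp_rw [neg_div, Finset.sum_div (s := Finset.univ), ← Finset.sum_neg_distrib,
    Complex.ofReal_sum, Complex.exp_sum]
  refine Finset.prod_congr rfl fun j _ => ?_
  rw [ULD.charFun_sum_increments (hB.brownian j).toIsPreBrownianReal hτ, neg_div]

lemma IsStdBrownian.ae_continuous {d : ℕ} {Ω : Type*} [MeasurableSpace Ω] {P : Measure Ω}
    {B : ℝ≥0 → Ω → E d} (hB : IsStdBrownian B P) :
    ∀ᵐ ω ∂P, ∀ j, Continuous fun t => B t ω j :=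
  ae_all_iff.2 fun j => (hB.brownian j).cont

lemma IsStdBrownian.ae_zero {d : ℕ} {Ω : Type*} [MeasurableSpace Ω] {P : Measure Ω}
    {B : ℝ≥0 → Ω → E d} (hB : IsStdBrownian B P) :
    ∀ᵐ ω ∂P, ∀ j, B 0 ω j = 0 :=
  ae_all_iff.2 fun j => (hB.brownian j).toIsPreBrownianReal.eval_zero_ae_eq_zero

/-- The characteristic function of the Wiener integral `∫ h dB`, written pathwise as
`-∫ ⟨B, h'⟩ ds`. -/
lemma IsStdBrownian.integral_cexp_wiener {d : ℕ} {Ω : Type*} [MeasurableSpace Ω] {P : Measure Ω}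
    [IsProbabilityMeasure P] {B : ℝ≥0 → Ω → E d} (hB : IsStdBrownian B P) {h h' : Fin d → ℝ → ℝ}
    {t : ℝ} (ht : 0 ≤ t) (hh : ∀ j s, HasDerivAt (h j) (h' j s) s) (hh' : ∀ j, Continuous (h' j))
    (hht : ∀ j, h j t = 0) :
    ∫ ω, Complex.exp (((∑ j, -∫ s in (0 : ℝ)..t, B s.toNNReal ω j * h' j s : ℝ) : ℂ) * Complex.I)
      ∂P = Complex.exp ((-(∑ j, ∫ s in (0 : ℝ)..t, h j s ^ 2) / 2 : ℝ)) := by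
  have hm := hB.measurable
  set S : ℕ → Ω → ℝ := fun n ω => ∑ j, ∑ k ∈ Finset.range n, h j (k * (t / n)) *
    (B (((k + 1 : ℕ) : ℝ) * (t / n)).toNNReal ω j - B ((k : ℝ) * (t / n)).toNNReal ω j) with hS
  have hSm : ∀ n, Measurable (S n) := fun n => by fun_prop
  have hlim : Tendsto (fun n => ∫ ω, Complex.exp (S n ω * Complex.I) ∂P) atTop (𝓝
      (∫ ω, Complex.exp (((∑ j, -∫ s in (0 : ℝ)..t, B s.toNNReal ω j * h' j s : ℝ) : ℂ) *
        Complex.I) ∂P)) := by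
    -- The sums converge along every continuous path starting at `0`, and the integrands have
    -- modulus one.
    refine tendsto_integral_of_dominated_convergence (fun _ => 1) (fun n => ?_)
      (integrable_const _) (fun n => ae_of_all _ fun ω => ?_) ?_
    · have := hSm n
      fun_prop
    · simp [Complex.norm_exp_ofReal_mul_I]
    · filter_upwards [hB.ae_continuous, hB.ae_zero] with ω hc h0
      have : Tendsto (fun n => S n ω) atTop
          (𝓝 (∑ j, -∫ s in (0 : ℝ)..t, B s.toNNReal ω j * h' j s)) :=
        tendsto_finsetSum _ fun j _ => tendsto_sum_mul_sub ht (hh j) (hh' j)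
          (w := fun s => B s.toNNReal ω j) ((hc j).comp continuous_real_toNNReal)
          (by simpa using h0 j) (hht j)
      exact (Complex.continuous_exp.tendsto _).comp
        (((Complex.continuous_ofReal.tendsto _).comp this).mul_const _)
  refine tendsto_nhds_unique hlim ?_
  have hR : Tendsto (fun n : ℕ => ∑ j, ∑ k ∈ Finset.range n, h j (k * (t / n)) ^ 2 *
      ((((k + 1 : ℕ) : ℝ) * (t / n)).toNNReal - ((k : ℝ) * (t / n)).toNNReal : ℝ)) atTop
      (𝓝 (∑ j, ∫ s in (0 : ℝ)..t, h j s ^ 2)) := by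
    refine tendsto_finsetSum _ fun j _ => ?_
    have hc : Continuous (h j) := continuous_iff_continuousAt.2 fun s => (hh j s).continuousAt
    have := tendsto_sum_mul_integral ht (f := fun s => h j s ^ 2) (by fun_prop)
      (continuous_const (y := (1 : ℝ))) (fun n k : ℕ => (k : ℝ) * (t / n))
      fun n k => ⟨le_rfl, by push_cast; nlinarith [div_nonneg ht (Nat.cast_nonneg (α := ℝ) n)]⟩
    simp only [mul_one, intervalIntegral.integral_const, smul_eq_mul] at this
    refine this.congr fun n => Finset.sum_congr rfl fun k _ => ?_
    rw [Real.coe_toNNReal _ (by positivity), Real.coe_toNNReal _ (by positivity)]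
  have hexp : ∀ n, ∫ ω, Complex.exp (S n ω * Complex.I) ∂P = Complex.exp
      ((-(∑ j, ∑ k ∈ Finset.range n, h j (k * (t / n)) ^ 2 *
      ((((k + 1 : ℕ) : ℝ) * (t / n)).toNNReal - ((k : ℝ) * (t / n)).toNNReal : ℝ)) / 2 : ℝ)) := by
    intro n
    rw [← charFun_map_apply_one (hSm n).aemeasurable]
    exact hB.charFun_sum_increments (τ := fun k : ℕ => ((k : ℝ) * (t / n)).toNNReal)
      (fun a b hab => Real.toNNReal_mono (by gcongr)) (fun j k => h j (k * (t / n))) n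
  simp_rw [hexp]
  exact (Complex.continuous_exp.tendsto _).comp
    ((Complex.continuous_ofReal.tendsto _).comp (hR.neg.div_const 2))

/-! ### Diagonalisation of the quadratic objective -/

section Spectral

variable {d : ℕ} {H : Matrix (Fin d) (Fin d) ℝ}

lemma inner_eigenvectorBasis_mulVec (hH : H.IsHermitian) (i : Fin d) (x : E d) :
    inner ℝ (hH.eigenvectorBasis i) (WithLp.toLp 2 (H.mulVec x.ofLp)) =
      hH.eigenvalues i * inner ℝ (hH.eigenvectorBasis i) x := by
  have h := Matrix.isSymmetric_toEuclideanLin_iff.2 hH (hH.eigenvectorBasis i) x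
  have h1 : Matrix.toEuclideanLin H (hH.eigenvectorBasis i) =
      hH.eigenvalues i • hH.eigenvectorBasis i := by
    ext j
    exact congrFun (hH.mulVec_eigenvectorBasis i) j
  rw [h1, inner_smul_left] at h
  exact h.symm

lemma quadObjective_eq_sum (hH : H.IsHermitian) (b₁ : E d) (c₁ : ℝ) (x : E d) :
    quadObjective H b₁ c₁ x = (1 / 2) * ∑ i, hH.eigenvalues i *
      inner ℝ (hH.eigenvectorBasis i) x ^ 2 -
      ∑ i, inner ℝ (hH.eigenvectorBasis i) b₁ * inner ℝ (hH.eigenvectorBasis i) x + c₁ := by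
  rw [quadObjective, ← hH.eigenvectorBasis.sum_inner_mul_inner x,
    ← hH.eigenvectorBasis.sum_inner_mul_inner b₁]
  simp_rw [inner_eigenvectorBasis_mulVec]
  congr 2
  · congr 1
    refine Finset.sum_congr rfl fun i _ => ?_
    rw [real_inner_comm x]
    ring
  · refine Finset.sum_congr rfl fun i _ => ?_
    rw [real_inner_comm b₁]

lemma hasGradientAt_quadObjective (hH : H.IsHermitian) (b₁ : E d) (c₁ : ℝ) (x : E d) :
    HasGradientAt (quadObjective H b₁ c₁) (∑ i, (hH.eigenvalues i *
      inner ℝ (hH.eigenvectorBasis i) x - inner ℝ (hH.eigenvectorBasis i) b₁) •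
      hH.eigenvectorBasis i) x := by
  rw [hasGradientAt_iff_hasFDerivAt, funext (quadObjective_eq_sum hH b₁ c₁)]
  have hd : ∀ i, HasFDerivAt (fun x : E d => inner ℝ (hH.eigenvectorBasis i) x)
      (innerSL ℝ (hH.eigenvectorBasis i)) x := fun i =>
    (innerSL ℝ (hH.eigenvectorBasis i)).hasFDerivAt
  refine ((((HasFDerivAt.fun_sum fun i _ => ((hd i).pow 2).const_mul (hH.eigenvalues i)).const_mul
    (1 / 2)).sub (HasFDerivAt.fun_sum fun i _ => (hd i).const_mul
    (inner ℝ (hH.eigenvectorBasis i) b₁))).add_const c₁).congr_fderiv ?_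
  ext v
  simp only [sub_apply, smul_apply, sum_apply, innerSL_apply_apply, smul_eq_mul,
    InnerProductSpace.toDual_apply_apply, sum_inner, inner_smul_left, Finset.mul_sum,
    ← Finset.sum_sub_distrib]
  refine Finset.sum_congr rfl fun i _ => ?_
  simp
  ring

lemma inner_gradient_quadObjective (hH : H.IsHermitian) (b₁ : E d) (c₁ : ℝ) (x : E d)
    (i : Fin d) : inner ℝ (hH.eigenvectorBasis i) (gradient (quadObjective H b₁ c₁) x) =
      hH.eigenvalues i * inner ℝ (hH.eigenvectorBasis i) x -
        inner ℝ (hH.eigenvectorBasis i) b₁ := by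
  rw [(hasGradientAt_quadObjective hH b₁ c₁ x).gradient]
  exact hH.eigenvectorBasis.orthonormal.inner_right_fintype _ _

lemma continuous_gradient_quadObjective (hH : H.IsHermitian) (b₁ : E d) (c₁ : ℝ) :
    Continuous (gradient (quadObjective H b₁ c₁)) := by
  rw [funext fun x => (hasGradientAt_quadObjective hH b₁ c₁ x).gradient]
  fun_prop

end Spectral

/-! ### Gaussian laws in an orthonormal basis -/

section Gaussian

variable {d : ℕ}

/-- The coordinates of `μ` in the orthonormal basis `e` are independent Gaussians with means `a i`
and variances `v i`, expressed through the characteristic function. -/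
def HasGaussianCoords (e : OrthonormalBasis (Fin d) ℝ (E d)) (a v : Fin d → ℝ)
    (μ : Measure (E d)) : Prop :=
  ∀ ξ, charFun μ ξ = Complex.exp
    (∑ i, (inner ℝ (e i) ξ * a i * Complex.I - inner ℝ (e i) ξ ^ 2 * v i / 2 : ℂ))

lemma integrable_cexp_quadratic_coords (e : OrthonormalBasis (Fin d) ℝ (E d)) {p : Fin d → ℝ}
    (hp : ∀ i, 0 < p i) (z : Fin d → ℂ) :
    Integrable fun x : E d => Complex.exp
      (-∑ i, p i * (inner ℝ (e i) x : ℂ) ^ 2 + ∑ i, z i * inner ℝ (e i) x) := by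
  rw [← e.repr.symm.measurePreserving.integrable_comp_emb
      e.repr.symm.toHomeomorph.measurableEmbedding,
    ← (PiLp.volume_preserving_toLp (Fin d)).integrable_comp_emb
      (MeasurableEquiv.toLp 2 _).measurableEmbedding]
  convert! GaussianFourier.integrable_cexp_neg_sum_mul_add (b := fun i => (p i : ℂ))
    (fun i => by simpa using hp i) z using 3 with y
  simp [← e.repr_apply_apply]

lemma integral_cexp_quadratic_coords (e : OrthonormalBasis (Fin d) ℝ (E d)) {p : Fin d → ℝ}
    (hp : ∀ i, 0 < p i) (z : Fin d → ℂ) :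
    ∫ x : E d, Complex.exp
      (-∑ i, p i * (inner ℝ (e i) x : ℂ) ^ 2 + ∑ i, z i * inner ℝ (e i) x) =
      (∏ i, (Real.pi / p i : ℂ) ^ (1 / 2 : ℂ)) * Complex.exp (∑ i, z i ^ 2 / (4 * p i)) := by
  rw [← e.repr.symm.measurePreserving.integral_comp
      e.repr.symm.toHomeomorph.measurableEmbedding,
    ← (PiLp.volume_preserving_toLp (Fin d)).integral_comp
      (MeasurableEquiv.toLp 2 _).measurableEmbedding, Complex.exp_sum, ← Finset.prod_mul_distrib]
  rw [← GaussianFourier.integral_cexp_neg_sum_mul_add (b := fun i => (p i : ℂ))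
    (fun i => by simpa using hp i) z]
  congr 1 with y
  simp [← e.repr_apply_apply]

variable {H : Matrix (Fin d) (Fin d) ℝ}

lemma ofReal_exp_quadObjective (hH : H.IsHermitian) (b₁ : E d) (c₁ β : ℝ) (x : E d) :
    (Real.exp (-β * quadObjective H b₁ c₁ x) : ℂ) = Complex.exp (-(β * c₁)) * Complex.exp
      (-∑ i, ((β * hH.eigenvalues i / 2 : ℝ) : ℂ) * (inner ℝ (hH.eigenvectorBasis i) x : ℂ) ^ 2 +
        ∑ i, (β * inner ℝ (hH.eigenvectorBasis i) b₁ : ℂ) *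
          inner ℝ (hH.eigenvectorBasis i) x) := by
  rw [quadObjective_eq_sum hH, ← Complex.exp_add, Complex.ofReal_exp]
  congr 1
  push_cast
  have h1 : ∑ i, (β * hH.eigenvalues i / 2 : ℂ) * (inner ℝ (hH.eigenvectorBasis i) x : ℂ) ^ 2 =
      β / 2 * ∑ i, (hH.eigenvalues i : ℂ) * (inner ℝ (hH.eigenvectorBasis i) x : ℂ) ^ 2 := by
    rw [Finset.mul_sum]; exact Finset.sum_congr rfl fun i _ => by ring
  have h2 : ∑ i, (β * inner ℝ (hH.eigenvectorBasis i) b₁ : ℂ) *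
      inner ℝ (hH.eigenvectorBasis i) x = β * ∑ i, (inner ℝ (hH.eigenvectorBasis i) b₁ : ℂ) *
      inner ℝ (hH.eigenvectorBasis i) x := by
    rw [Finset.mul_sum]; exact Finset.sum_congr rfl fun i _ => by ring
  rw [h1, h2]
  ring

lemma integrable_exp_quadObjective (hH : H.PosDef) (b₁ : E d) (c₁ : ℝ) {β : ℝ} (hβ : 0 < β) :
    Integrable fun x => Real.exp (-β * quadObjective H b₁ c₁ x) := by
  have h := (integrable_cexp_quadratic_coords hH.isHermitian.eigenvectorBasis
    (p := fun i => β * hH.isHermitian.eigenvalues i / 2)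
    (fun i => by have := hH.eigenvalues_pos i; positivity)
    (fun i => β * inner ℝ (hH.isHermitian.eigenvectorBasis i) b₁)).const_mul
    (Complex.exp (-(β * c₁)))
  simp_rw [← ofReal_exp_quadObjective hH.isHermitian b₁ c₁ β] at h
  exact h.re.congr (ae_of_all _ fun x => Complex.ofReal_re _)

lemma isProbabilityMeasure_gibbs (hH : H.PosDef) (b₁ : E d) (c₁ : ℝ) {β : ℝ} (hβ : 0 < β) :
    IsProbabilityMeasure (gibbs β (quadObjective H b₁ c₁)) :=
  isProbabilityMeasure_tilted (integrable_exp_quadObjective hH b₁ c₁ hβ)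

/-- Both the normalising constant and the Fourier integral are Gaussian integrals with the same
prefactor `K`. In their quotient only `((β b + iξ)² - (β b)²) / (2 β l)` survives in each coordinate
exponent. -/
lemma hasGaussianCoords_gibbs (hH : H.PosDef) (b₁ : E d) (c₁ : ℝ) {β : ℝ} (hβ : 0 < β) :
    HasGaussianCoords hH.isHermitian.eigenvectorBasis
      (fun i => inner ℝ (hH.isHermitian.eigenvectorBasis i) b₁ / hH.isHermitian.eigenvalues i)
      (fun i => (β * hH.isHermitian.eigenvalues i)⁻¹) (gibbs β (quadObjective H b₁ c₁)) := by
  intro ξ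
  set e := hH.isHermitian.eigenvectorBasis
  set l := hH.isHermitian.eigenvalues
  have hl0 : ∀ i, 0 < l i := hH.eigenvalues_pos
  have hp : ∀ i, 0 < β * l i / 2 := fun i => by have := hl0 i; positivity
  set K : ℂ := Complex.exp (-(β * c₁)) * ∏ i, (Real.pi / (β * l i / 2 : ℝ) : ℂ) ^ (1 / 2 : ℂ)
    with hK
  have hK0 : K ≠ 0 := by
    refine mul_ne_zero (Complex.exp_ne_zero _) (Finset.prod_ne_zero_iff.2 fun i _ => ?_)
    rw [Complex.cpow_ne_zero_iff]
    left
    have := (hp i).ne'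
    have h2 := Real.pi_ne_zero
    exact div_ne_zero (by exact_mod_cast h2) (by exact_mod_cast this)
  have hZ : ((∫ x, Real.exp (-β * quadObjective H b₁ c₁ x) : ℝ) : ℂ) =
      K * Complex.exp (∑ i, (β * inner ℝ (e i) b₁ : ℂ) ^ 2 / (4 * (β * l i / 2 : ℝ))) := by
    rw [← integral_complex_ofReal]
    simp_rw [ofReal_exp_quadObjective hH.isHermitian b₁ c₁ β]
    rw [integral_const_mul, integral_cexp_quadratic_coords e hp, hK, mul_assoc]
  have hN : ∫ x, (Real.exp (-β * quadObjective H b₁ c₁ x) : ℂ) *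
      Complex.exp (inner ℝ x ξ * Complex.I) =
      K * Complex.exp (∑ i, (β * inner ℝ (e i) b₁ + inner ℝ (e i) ξ * Complex.I : ℂ) ^ 2 /
        (4 * (β * l i / 2 : ℝ))) := by
    rw [hK, mul_assoc, ← integral_cexp_quadratic_coords e hp, ← integral_const_mul]
    congr 1 with x
    rw [ofReal_exp_quadObjective hH.isHermitian b₁ c₁ β, mul_assoc, ← Complex.exp_add,
      ← e.sum_inner_mul_inner x ξ, Complex.ofReal_sum, Finset.sum_mul, add_assoc,
      ← Finset.sum_add_distrib]
    congr 3
    refine Finset.sum_congr rfl fun i _ => ?_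
    rw [real_inner_comm x]
    push_cast
    ring
  rw [charFun_apply, gibbs, integral_tilted]
  calc _ = ∫ x, (((∫ x, Real.exp (-β * quadObjective H b₁ c₁ x) : ℝ) : ℂ))⁻¹ *
        ((Real.exp (-β * quadObjective H b₁ c₁ x) : ℂ) *
          Complex.exp (inner ℝ x ξ * Complex.I)) := by
        congr 1 with x
        rw [Complex.real_smul]
        push_cast
        ring
    _ = _ := by
        rw [integral_const_mul, hN, hZ, mul_inv, mul_mul_mul_comm, inv_mul_cancel₀ hK0, one_mul,
          ← Complex.exp_neg, ← Complex.exp_add, ← Finset.sum_neg_distrib, ← Finset.sum_add_distrib]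
        congr 1
        refine Finset.sum_congr rfl fun i _ => ?_
        have h1 : (l i : ℂ) ≠ 0 := by exact_mod_cast (hl0 i).ne'
        have h2 : (β : ℂ) ≠ 0 := by exact_mod_cast hβ.ne'
        push_cast
        field_simp
        linear_combination 4 * (inner ℝ (e i) ξ : ℂ) ^ 2 * Complex.I_sq

lemma hasGaussianCoords_multivariateGaussian (e : OrthonormalBasis (Fin d) ℝ (E d)) {β : ℝ}
    (hβ : 0 < β) : HasGaussianCoords e (fun _ => 0) (fun _ => β⁻¹)
      (multivariateGaussian 0 (β⁻¹ • (1 : Matrix (Fin d) (Fin d) ℝ))) := by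
  intro ξ
  have hpos : (β⁻¹ • (1 : Matrix (Fin d) (Fin d) ℝ)).PosSemidef :=
    Matrix.PosSemidef.one.smul (by positivity)
  rw [charFun_multivariateGaussian hpos]
  congr 1
  have h1 : ξ.ofLp ⬝ᵥ (β⁻¹ • (1 : Matrix (Fin d) (Fin d) ℝ)) *ᵥ ξ.ofLp =
      ∑ i, inner ℝ (e i) ξ ^ 2 * β⁻¹ := by
    rw [Matrix.smul_mulVec, Matrix.one_mulVec, dotProduct_smul, ← Finset.sum_mul,
      e.sum_sq_inner_right, EuclideanSpace.real_norm_sq_eq, smul_eq_mul, mul_comm]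
    simp [dotProduct, sq]
  rw [h1]
  simp [Finset.sum_div]

/-- Evaluating the characteristic function along the line `s • e i` isolates one coordinate. -/
lemma HasGaussianCoords.map_inner {e : OrthonormalBasis (Fin d) ℝ (E d)} {a v : Fin d → ℝ}
    {μ : Measure (E d)} [IsProbabilityMeasure μ] (h : HasGaussianCoords e a v μ) (i : Fin d)
    (hv : 0 ≤ v i) :
    μ.map (fun x => inner ℝ (e i) x) = gaussianReal (a i) (v i).toNNReal := by
  have : IsProbabilityMeasure (μ.map (fun x => inner ℝ (e i) x)) :=
    Measure.isProbabilityMeasure_map (by fun_prop)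
  refine Measure.ext_of_charFun ?_
  ext s
  rw [charFun_gaussianReal, Real.coe_toNNReal _ hv, charFun_apply_real,
    integral_map (by fun_prop) (by fun_prop)]
  have h1 := h (s • e i)
  rw [charFun_apply] at h1
  simp_rw [inner_smul_right, real_inner_comm (e i)] at h1
  simp only [Complex.ofReal_mul] at h1
  rw [h1]
  congr 1
  rw [Finset.sum_eq_single i]
  · simp
    ring
  · intro j _ hj
    rw [e.orthonormal.2 hj.symm]
    simp
  · simp

lemma integral_sub_sq_gaussianReal (a c : ℝ) (v : ℝ≥0) :
    ∫ x, (x - c) ^ 2 ∂(gaussianReal a v) = v + (a - c) ^ 2 := by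
  have hm : MemLp id 2 (gaussianReal a v) := memLp_id_gaussianReal 2
  have h := variance_eq_sub (hm.sub (memLp_const c))
  rw [show (id - fun _ : ℝ => c) = fun x : ℝ => x - c from rfl,
    variance_sub_const (by fun_prop)] at h
  have h2 : ∫ x, (x - c) ∂(gaussianReal a v) = a - c := by
    rw [integral_sub (f := fun x : ℝ => x)
      (hm.integrable (by norm_num)) (integrable_const _)]
    simp
  rw [h2] at h
  have h3 : Var[fun x : ℝ => x; gaussianReal a v] = v := variance_fun_id_gaussianReal
  rw [h3] at h
  simp only [Pi.pow_apply] at h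
  linarith

namespace HasGaussianCoords

variable {e : OrthonormalBasis (Fin d) ℝ (E d)} {a v : Fin d → ℝ}
    {μ : Measure (E d)} [IsProbabilityMeasure μ]

lemma memLp_inner (h : HasGaussianCoords e a v μ) (i : Fin d) (hv : 0 ≤ v i) :
    MemLp (fun x => inner ℝ (e i) x) 2 μ := by
  have : MemLp id 2 (μ.map (fun x => inner ℝ (e i) x)) := by
    rw [h.map_inner i hv]; exact memLp_id_gaussianReal 2
  exact this.comp_of_map (by fun_prop)

lemma integral_inner (h : HasGaussianCoords e a v μ) (i : Fin d) (hv : 0 ≤ v i) :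
    ∫ x, inner ℝ (e i) x ∂μ = a i := by
  have := integral_map (μ := μ) (φ := fun x => inner ℝ (e i) x) (f := fun y : ℝ => y)
    (by fun_prop) (by fun_prop)
  rw [← this, h.map_inner i hv]
  simp

lemma integral_inner_sub_sq (h : HasGaussianCoords e a v μ) (i : Fin d) (hv : 0 ≤ v i) (c : ℝ) :
    ∫ x, (inner ℝ (e i) x - c) ^ 2 ∂μ = v i + (a i - c) ^ 2 := by
  have := integral_map (μ := μ) (φ := fun x => inner ℝ (e i) x) (f := fun y : ℝ => (y - c) ^ 2)
    (by fun_prop) (by fun_prop)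
  rw [← this, h.map_inner i hv, integral_sub_sq_gaussianReal, Real.coe_toNNReal _ hv]

end HasGaussianCoords

end Gaussian

/-! ### The accumulated noise and the solution formula -/

section Noise

variable {d : ℕ} {Ω : Type*} [MeasurableSpace Ω] {P : Measure Ω} {B V X : ℝ≥0 → Ω → E d}
  {e : OrthonormalBasis (Fin d) ℝ (E d)} {γ : ℝ} {l : Fin d → ℝ} {g g' : Fin d → ℝ → ℝ}

/-- The `i`-th coordinate at time `t`, in the basis `e`, of the noise accumulated by oscillators
whose impulse responses have derivatives `g' i` and that are driven by `σ B`. -/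
noncomputable def noise (e : OrthonormalBasis (Fin d) ℝ (E d)) (g' : Fin d → ℝ → ℝ)
    (B : ℝ≥0 → Ω → E d) (σ t : ℝ) (i : Fin d) (ω : Ω) : ℝ :=
  σ * ∫ s in (0 : ℝ)..t, g' i (t - s) * inner ℝ (e i) (B s.toNNReal ω)

lemma real_inner_eq_sum (x y : E d) : inner ℝ x y = ∑ j, x j * y j := by
  simp [PiLp.inner_apply, mul_comm]

lemma IsStdBrownian.ae_continuous_inner (hB : IsStdBrownian B P) :
    ∀ᵐ ω ∂P, ∀ x : E d, Continuous fun t => inner ℝ x (B t ω) := by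
  filter_upwards [hB.ae_continuous] with ω hc x
  simp_rw [real_inner_eq_sum]
  exact continuous_finsetSum _ fun j _ => continuous_const.mul (hc j)

lemma sum_mul_integral_kernel_eq {t : ℝ} {k b : Fin d → ℝ → ℝ} (hk : ∀ i, Continuous (k i))
    (hb : ∀ j, Continuous (b j)) (σ : ℝ) (c : Fin d → ℝ) (M : Fin d → Fin d → ℝ) :
    ∑ i, c i * (σ * ∫ s in (0 : ℝ)..t, k i (t - s) * ∑ j, M i j * b j s) =
      ∑ j, -∫ s in (0 : ℝ)..t, b j s * ∑ i, σ * c i * M i j * -k i (t - s) := by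
  simp_rw [← intervalIntegral.integral_const_mul, ← intervalIntegral.integral_neg]
  rw [← intervalIntegral.integral_finsetSum
      fun i _ => Continuous.intervalIntegrable (by fun_prop) _ _,
    ← intervalIntegral.integral_finsetSum
      fun j _ => Continuous.intervalIntegrable (by fun_prop) _ _]
  congr 1 with s
  simp_rw [Finset.mul_sum, ← Finset.sum_neg_distrib]
  rw [Finset.sum_comm]
  exact Finset.sum_congr rfl fun i _ => Finset.sum_congr rfl fun j _ => by ring

lemma IsStdBrownian.integral_cexp_noise [IsProbabilityMeasure P] (hB : IsStdBrownian B P)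
    (hg : ∀ i, IsImpulseResponse γ (l i) (g i) (g' i)) (σ : ℝ) {t : ℝ} (ht : 0 ≤ t)
    (c : Fin d → ℝ) :
    ∫ ω, Complex.exp ((∑ i, c i * noise e g' B σ t i ω : ℝ) * Complex.I) ∂P =
      Complex.exp ((-(∑ i, σ ^ 2 * c i ^ 2 * ∫ s in (0 : ℝ)..t, g i (t - s) ^ 2) / 2 : ℝ)) := by
  have hgc : ∀ i, Continuous (g i) := fun i => (hg i).continuous
  have hgc' : ∀ i, Continuous (g' i) := fun i => (hg i).continuous_deriv
  -- Integration by parts turns the kernel `g'` against `B` into `g` against `dB`; the boundary term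
  -- vanishes because `g 0 = 0`. The index `j` runs over the standard coordinates, in which `B` has
  -- independent components.
  set h : Fin d → ℝ → ℝ := fun j s => ∑ i, σ * c i * e i j * g i (t - s) with hh
  set h' : Fin d → ℝ → ℝ := fun j s => ∑ i, σ * c i * e i j * -g' i (t - s) with hh'
  have key := hB.integral_cexp_wiener (h := h) (h' := h') ht (fun j s => ?_)
    (fun j => by fun_prop) (fun j => by simp [hh, (hg _).zero])
  · have hL : ∀ᵐ ω ∂P, ∑ i, c i * noise e g' B σ t i ω =
        ∑ j, -∫ s in (0 : ℝ)..t, B s.toNNReal ω j * h' j s := by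
      filter_upwards [hB.ae_continuous] with ω hc
      have hc' : ∀ j, Continuous fun s : ℝ => B s.toNNReal ω j := fun j =>
        (hc j).comp continuous_real_toNNReal
      simp_rw [noise, real_inner_eq_sum]
      exact sum_mul_integral_kernel_eq hgc' hc' σ c fun i j => e i j
    have hR : ∑ j, ∫ s in (0 : ℝ)..t, h j s ^ 2 =
        ∑ i, σ ^ 2 * c i ^ 2 * ∫ s in (0 : ℝ)..t, g i (t - s) ^ 2 := by
      simp_rw [← intervalIntegral.integral_const_mul]
      rw [← intervalIntegral.integral_finsetSum, ← intervalIntegral.integral_finsetSum]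
      · congr 1 with s
        -- Parseval passes from standard coordinates back to the basis `e`, removing the cross terms
        -- between different `i`.
        have h1 := e.sum_sq_inner_right (∑ i, (σ * c i * g i (t - s)) • e i)
        rw [EuclideanSpace.real_norm_sq_eq] at h1
        calc _ = ∑ j, (∑ i, (σ * c i * g i (t - s)) • e i : E d) j ^ 2 := by
              refine Finset.sum_congr rfl fun j _ => ?_
              simp only [hh, WithLp.ofLp_sum, Finset.sum_apply, PiLp.smul_apply, smul_eq_mul]
              congr 1
              exact Finset.sum_congr rfl fun i _ => by ring
          _ = _ := by
              rw [← h1]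
              refine Finset.sum_congr rfl fun i _ => ?_
              rw [e.orthonormal.inner_right_fintype]
              ring
      · exact fun j _ => Continuous.intervalIntegrable (by fun_prop) _ _
      · exact fun j _ => Continuous.intervalIntegrable (by fun_prop) _ _
    rw [← hR, ← key]
    refine integral_congr_ae ?_
    filter_upwards [hL] with ω hω
    rw [hω]
  · refine HasDerivAt.fun_sum fun i _ => HasDerivAt.const_mul _ ?_
    exact (((hg i).hasDerivAt (t - s)).comp s ((hasDerivAt_id s).const_sub t)).congr_deriv (by ring)

variable {H : Matrix (Fin d) (Fin d) ℝ} {b₁ : E d} {c₁ β : ℝ}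

/-- The coordinates of an underdamped Langevin diffusion in the eigenbasis of the Hessian. -/
lemma IsUnderdampedLangevin.inner_eq (hH : H.PosDef)
    (hVX : IsUnderdampedLangevin (quadObjective H b₁ c₁) γ β P B V X)
    (hg : ∀ i, IsImpulseResponse γ (hH.isHermitian.eigenvalues i) (g i) (g' i)) (t : ℝ≥0) :
    ∀ᵐ ω ∂P, ∀ i, inner ℝ (hH.isHermitian.eigenvectorBasis i) (X t ω) =
      inner ℝ (hH.isHermitian.eigenvectorBasis i) b₁ / hH.isHermitian.eigenvalues i +
      (g' i t + γ * g i t) * (inner ℝ (hH.isHermitian.eigenvectorBasis i) (X 0 ω) -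
        inner ℝ (hH.isHermitian.eigenvectorBasis i) b₁ / hH.isHermitian.eigenvalues i) +
      g i t * inner ℝ (hH.isHermitian.eigenvectorBasis i) (V 0 ω) +
      noise hH.isHermitian.eigenvectorBasis g' B √(2 * γ * β⁻¹) t i ω := by
  filter_upwards [hVX.continuous_V, hVX.continuous_X, hVX.eq_V, hVX.eq_X,
    hVX.brownian.ae_continuous_inner] with ω hcV hcX hV hX hcB i
  set e := hH.isHermitian.eigenvectorBasis
  set l := hH.isHermitian.eigenvalues
  have hl : l i ≠ 0 := (hH.eigenvalues_pos i).ne'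
  have hcV' : Continuous fun s : ℝ => V s.toNNReal ω := hcV.comp continuous_real_toNNReal
  have hcX' : Continuous fun s : ℝ => X s.toNNReal ω := hcX.comp continuous_real_toNNReal
  have hcB' : Continuous fun s : ℝ => inner ℝ (e i) (B s.toNNReal ω) :=
    (hcB (e i)).comp continuous_real_toNNReal
  have hgrad := (continuous_gradient_quadObjective hH.isHermitian b₁ c₁).comp hcX'
  have hcomm : ∀ (f : ℝ → E d), Continuous f → ∀ s : ℝ,
      inner ℝ (e i) (∫ r in (0 : ℝ)..s, f r) = ∫ r in (0 : ℝ)..s, inner ℝ (e i) (f r) :=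
    fun f hf s => ((innerSL ℝ (e i)).intervalIntegral_comp_comm (hf.intervalIntegrable 0 s)).symm
  -- Centring at the equilibrium `⟨e i, b₁⟩ / l i` absorbs the constant force, leaving the equation
  -- of `duhamel`.
  have := (hg i).duhamel (x := fun s => inner ℝ (e i) (X s.toNNReal ω) - inner ℝ (e i) b₁ / l i)
    (v := fun s => inner ℝ (e i) (V s.toNNReal ω)) (w := fun s => inner ℝ (e i) (B s.toNNReal ω))
    (σ := √(2 * γ * β⁻¹)) (t := t) (by fun_prop) (by fun_prop) hcB' t.2 (fun s hs => ?_)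
    (fun s hs => ?_)
  · simp only [Real.toNNReal_coe, Real.toNNReal_zero] at this
    rw [noise]
    linarith
  · have := hX s.toNNReal
    rw [Real.coe_toNNReal _ hs.1] at this
    rw [this, inner_add_right, hcomm _ hcV', Real.toNNReal_zero]
    ring
  · have := hV s.toNNReal
    rw [Real.coe_toNNReal _ hs.1] at this
    rw [this, inner_add_right, inner_sub_right, hcomm (fun r => γ • V r.toNNReal ω +
        gradient (quadObjective H b₁ c₁) (X r.toNNReal ω)) ((hcV'.const_smul γ).add hgrad),
      Real.toNNReal_zero, inner_smul_right]
    congr 2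
    refine intervalIntegral.integral_congr fun r _ => ?_
    simp only [inner_add_right, inner_smul_right]
    have h1 : inner ℝ (e i) (gradient (quadObjective H b₁ c₁) (X r.toNNReal ω)) =
        l i * inner ℝ (e i) (X r.toNNReal ω) - inner ℝ (e i) b₁ :=
      inner_gradient_quadObjective hH.isHermitian b₁ c₁ _ i
    rw [h1]
    field_simp

end Noise

/-! ### Wasserstein distance: point masses and couplings -/

section Wasserstein

variable {d : ℕ}

/-- Any coupling with a point mass has its first component almost surely constant, so every coupling
has the same cost. -/
lemma W2_dirac_left (x₀ : E d) (μ : Measure (E d)) [IsProbabilityMeasure μ] :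
    W2 (Measure.dirac x₀) μ = (∫⁻ y, ‖x₀ - y‖ₑ ^ 2 ∂μ) ^ (1 / 2 : ℝ) := by
  refine le_antisymm ?_ ?_
  · refine iInf₂_le_of_le (μ.map fun y => (x₀, y)) ⟨?_, ?_⟩ (le_of_eq ?_)
    · rw [Measure.fst, Measure.map_map (by fun_prop) (by fun_prop)]
      simp [Function.comp_def]
    · rw [Measure.snd, Measure.map_map (by fun_prop) (by fun_prop)]
      simp [Function.comp_def]
    · rw [lintegral_map (by fun_prop) (by fun_prop)]
  · refine le_iInf₂ fun ρ hρ => ?_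
    have hae : ∀ᵐ p ∂ρ, p.1 = x₀ := by
      have : ∀ᵐ x ∂ρ.fst, x = x₀ := by
        rw [hρ.1]
        exact (ae_dirac_iff (p := (· = x₀)) (measurableSet_singleton x₀)).2 rfl
      exact ae_of_ae_map (by fun_prop) this
    rw [← hρ.2, Measure.snd, lintegral_map (by fun_prop) (by fun_prop)]
    refine le_of_eq (congrArg (· ^ (1 / 2 : ℝ)) (lintegral_congr_ae ?_))
    filter_upwards [hae] with p hp
    rw [hp]

lemma W2_map_le {Ω : Type*} [MeasurableSpace Ω] (Q : Measure Ω) {Y Z : Ω → E d}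
    (hY : Measurable Y) (hZ : Measurable Z) :
    W2 (Q.map Y) (Q.map Z) ≤ (∫⁻ ω, ‖Y ω - Z ω‖ₑ ^ 2 ∂Q) ^ (1 / 2 : ℝ) := by
  refine iInf₂_le_of_le (Q.map fun ω => (Y ω, Z ω)) ⟨?_, ?_⟩ (le_of_eq ?_)
  · rw [Measure.fst, Measure.map_map (by fun_prop) (by fun_prop)]
    rfl
  · rw [Measure.snd, Measure.map_map (by fun_prop) (by fun_prop)]
    rfl
  · rw [lintegral_map (by fun_prop) (by fun_prop)]

lemma lintegral_enorm_sq_eq_sum {Ω : Type*} [MeasurableSpace Ω] {Q : Measure Ω}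
    (e : OrthonormalBasis (Fin d) ℝ (E d)) {Y : Ω → E d}
    (hY : ∀ i, MemLp (fun ω => inner ℝ (e i) (Y ω)) 2 Q) :
    ∫⁻ ω, ‖Y ω‖ₑ ^ 2 ∂Q = ENNReal.ofReal (∑ i, ∫ ω, inner ℝ (e i) (Y ω) ^ 2 ∂Q) := by
  rw [← integral_finsetSum _ fun i _ => (hY i).integrable_sq,
    ofReal_integral_eq_lintegral_ofReal (integrable_finsetSum _ fun i _ => (hY i).integrable_sq)
      (ae_of_all _ fun ω => Finset.sum_nonneg fun i _ => sq_nonneg _)]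
  congr 1 with ω
  rw [e.sum_sq_inner_right, ENNReal.ofReal_pow (norm_nonneg _), ofReal_norm]

lemma HasGaussianCoords.lintegral_enorm_sub_sq {e : OrthonormalBasis (Fin d) ℝ (E d)}
    {a v : Fin d → ℝ} {μ : Measure (E d)} [IsProbabilityMeasure μ] (h : HasGaussianCoords e a v μ)
    (hv : ∀ i, 0 ≤ v i) (x₀ : E d) :
    ∫⁻ y, ‖x₀ - y‖ₑ ^ 2 ∂μ = ENNReal.ofReal (∑ i, (v i + (a i - inner ℝ (e i) x₀) ^ 2)) := by
  rw [lintegral_enorm_sq_eq_sum e]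
  · congr 2 with i
    rw [← h.integral_inner_sub_sq i (hv i)]
    congr 1 with y
    rw [inner_sub_right]
    ring
  · intro i
    simp_rw [inner_sub_right]
    exact (memLp_const _).sub (h.memLp_inner i (hv i))

end Wasserstein

/-! ### Synchronous coupling and contraction -/

section Coupling

variable {d : ℕ} {Ω : Type*} [MeasurableSpace Ω] {P : Measure Ω} {B V X : ℝ≥0 → Ω → E d}
  {H : Matrix (Fin d) (Fin d) ℝ} {b₁ : E d} {c₁ γ β : ℝ} {g g' : Fin d → ℝ → ℝ}

/-- The process driven by the same noise as `X`, started at `x` with velocity `v`; here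
`z = ((ω, v), x)`. -/
noncomputable def synchronous (e : OrthonormalBasis (Fin d) ℝ (E d)) (γ : ℝ) (g g' : Fin d → ℝ → ℝ)
    (V X : ℝ≥0 → Ω → E d) (x₀ : E d) (t : ℝ≥0) (z : (Ω × E d) × E d) : E d :=
  X t z.1.1 + ∑ i, ((g' i t + γ * g i t) * inner ℝ (e i) (z.2 - x₀) +
    g i t * inner ℝ (e i) (z.1.2 - V 0 z.1.1)) • e i

lemma measurable_synchronous (e : OrthonormalBasis (Fin d) ℝ (E d)) (hV : Measurable (V 0))
    (hX : ∀ t, Measurable (X t)) (x₀ : E d) (t : ℝ≥0) :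
    Measurable (synchronous e γ g g' V X x₀ t) := by
  have := hX t
  unfold synchronous
  fun_prop

/-- Started from the invariant law, the synchronously coupled process stays stationary. -/
lemma IsUnderdampedLangevin.map_synchronous [IsProbabilityMeasure P] (hH : H.PosDef) (hγ : 0 < γ)
    (hβ : 0 < β) (hVX : IsUnderdampedLangevin (quadObjective H b₁ c₁) γ β P B V X)
    (hg : ∀ i, IsImpulseResponse γ (hH.isHermitian.eigenvalues i) (g i) (g' i)) {x₀ : E d}
    (hX₀ : ∀ᵐ ω ∂P, X 0 ω = x₀) (t : ℝ≥0) :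
    ((P.prod (multivariateGaussian 0 (β⁻¹ • (1 : Matrix (Fin d) (Fin d) ℝ)))).prod
      (gibbs β (quadObjective H b₁ c₁))).map
      (synchronous hH.isHermitian.eigenvectorBasis γ g g' V X x₀ t) =
      gibbs β (quadObjective H b₁ c₁) := by
  have hprob := isProbabilityMeasure_gibbs hH b₁ c₁ hβ
  have hπ := hasGaussianCoords_gibbs hH b₁ c₁ hβ
  have hν := hasGaussianCoords_multivariateGaussian hH.isHermitian.eigenvectorBasis hβ
  have hin := hVX.inner_eq hH hg t
  have hl0 : ∀ i, 0 < hH.isHermitian.eigenvalues i := hH.eigenvalues_pos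
  set e := hH.isHermitian.eigenvectorBasis
  set l := hH.isHermitian.eigenvalues
  set π := gibbs β (quadObjective H b₁ c₁)
  set ν := multivariateGaussian 0 (β⁻¹ • (1 : Matrix (Fin d) (Fin d) ℝ))
  have hm := measurable_synchronous (γ := γ) (g := g) (g' := g') e (hVX.measurable_V 0)
    hVX.measurable_X x₀ t
  have := Measure.isProbabilityMeasure_map (μ := (P.prod ν).prod π) hm.aemeasurable
  refine Measure.ext_of_charFun ?_
  ext ξ
  set A : Fin d → ℝ := fun i => g' i t + γ * g i t with hA
  set n : Fin d → ℝ := fun i => inner ℝ (e i) b₁ / l i with hn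
  set c : Fin d → ℝ := fun i => inner ℝ (e i) ξ with hc
  set ξA : E d := ∑ i, (c i * A i) • e i with hξA
  set ξG : E d := ∑ i, (c i * g i t) • e i with hξG
  have hξA' : ∀ i, inner ℝ (e i) ξA = c i * A i := fun i => e.orthonormal.inner_right_fintype _ i
  have hξG' : ∀ i, inner ℝ (e i) ξG = c i * g i t := fun i =>
    e.orthonormal.inner_right_fintype _ i
  -- The contributions of `X 0` and `V 0` cancel. What remains is a sum of functions of `ω`, `v` and
  -- `x` separately, so the characteristic function factors over the product measure.
  have hae : ∀ᵐ z ∂((P.prod ν).prod π), inner ℝ (synchronous e γ g g' V X x₀ t z) ξ =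
      ∑ i, c i * noise e g' B √(2 * γ * β⁻¹) t i z.1.1 + inner ℝ z.1.2 ξG +
        (inner ℝ z.2 ξA + ∑ i, c i * (n i * (1 - A i))) := by
    have h1 : ∀ᵐ z ∂((P.prod ν).prod π), (∀ i, inner ℝ (e i) (X t z.1.1) = n i +
        A i * (inner ℝ (e i) (X 0 z.1.1) - n i) + g i t * inner ℝ (e i) (V 0 z.1.1) +
        noise e g' B √(2 * γ * β⁻¹) t i z.1.1) ∧ X 0 z.1.1 = x₀ :=
      (Measure.quasiMeasurePreserving_fst.ae (Measure.quasiMeasurePreserving_fst.ae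
        (hin.and hX₀)))
    filter_upwards [h1] with z ⟨hz, hz0⟩
    rw [← e.sum_inner_mul_inner, ← e.sum_inner_mul_inner z.1.2, ← e.sum_inner_mul_inner z.2,
      ← Finset.sum_add_distrib, ← Finset.sum_add_distrib, ← Finset.sum_add_distrib]
    refine Finset.sum_congr rfl fun i _ => ?_
    rw [hξA', hξG', real_inner_comm _ (synchronous _ _ _ _ _ _ _ _ _), synchronous,
      inner_add_right, e.orthonormal.inner_right_fintype, hz i, hz0, inner_sub_right,
      inner_sub_right, real_inner_comm (e i) z.1.2, real_inner_comm (e i) z.2]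
    ring
  have hN := hVX.brownian.integral_cexp_noise (e := e) hg √(2 * γ * β⁻¹) t.coe_nonneg c
  rw [charFun_apply, integral_map hm.aemeasurable (by fun_prop)]
  calc _ = ∫ z, (Complex.exp ((∑ i, c i * noise e g' B √(2 * γ * β⁻¹) t i z.1.1 : ℝ) *
          Complex.I) * Complex.exp (inner ℝ z.1.2 ξG * Complex.I)) *
        (Complex.exp (inner ℝ z.2 ξA * Complex.I) *
          Complex.exp ((∑ i, c i * (n i * (1 - A i)) : ℝ) * Complex.I)) ∂((P.prod ν).prod π) := by
        refine integral_congr_ae ?_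
        filter_upwards [hae] with z hz
        rw [hz, ← Complex.exp_add, ← Complex.exp_add, ← Complex.exp_add, ← add_mul, ← add_mul,
          ← add_mul]
        push_cast
        rfl
    _ = Complex.exp ((-(∑ i, √(2 * γ * β⁻¹) ^ 2 * c i ^ 2 *
          ∫ s in (0 : ℝ)..t, g i (t - s) ^ 2) / 2 : ℝ)) * charFun ν ξG *
        (charFun π ξA * Complex.exp ((∑ i, c i * (n i * (1 - A i)) : ℝ) * Complex.I)) := by
        rw [integral_prod_mul (f := fun y : Ω × E d =>
            Complex.exp ((∑ i, c i * noise e g' B √(2 * γ * β⁻¹) t i y.1 : ℝ) * Complex.I) *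
              Complex.exp (inner ℝ y.2 ξG * Complex.I))
            (g := fun x => Complex.exp (inner ℝ x ξA * Complex.I) *
              Complex.exp ((∑ i, c i * (n i * (1 - A i)) : ℝ) * Complex.I)),
          integral_prod_mul (f := fun y => Complex.exp ((∑ i, c i *
              noise e g' B √(2 * γ * β⁻¹) t i y : ℝ) * Complex.I))
            (g := fun y => Complex.exp (inner ℝ y ξG * Complex.I)),
          hN, integral_mul_const, charFun_apply,
          charFun_apply]
    _ = _ := by
        rw [hν, hπ, hπ, ← Complex.exp_add, ← Complex.exp_add, ← Complex.exp_add, neg_div,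
          Finset.sum_div, ← Finset.sum_neg_distrib, Complex.ofReal_sum, Complex.ofReal_sum,
          Finset.sum_mul, ← Finset.sum_add_distrib, ← Finset.sum_add_distrib,
          ← Finset.sum_add_distrib]
        congr 1
        refine Finset.sum_congr rfl fun i _ => ?_
        rw [hξA', hξG', Real.sq_sqrt (by positivity)]
        -- Multiplied by `1/(β l)`, this says that the variances from the initial position, the
        -- initial velocity and the noise add up to the Gibbs variance.
        have hen : (A i : ℂ) ^ 2 + l i * (g i t : ℂ) ^ 2 +
            2 * γ * l i * ((∫ s in (0 : ℝ)..t, g i (t - s) ^ 2 : ℝ) : ℂ) = 1 := by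
          exact_mod_cast (hg i).energy_identity t
        have h1 : (l i : ℂ) ≠ 0 := by exact_mod_cast (hl0 i).ne'
        have h2 : (β : ℂ) ≠ 0 := by exact_mod_cast hβ.ne'
        push_cast
        have hni : (n i : ℂ) = inner ℝ (e i) b₁ / l i := by simp [hn]
        generalize ((∫ s in (0 : ℝ)..t, g i (t - s) ^ 2 : ℝ) : ℂ) = J at hen ⊢
        change _ = (c i : ℂ) * n i * Complex.I - (c i : ℂ) ^ 2 * (β * l i : ℂ)⁻¹ / 2
        field_simp
        linear_combination (-(c i : ℂ) ^ 2) * hen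

/-- The initial velocity is centred, with coordinates of variance at most `β⁻¹`. -/
lemma initial_velocity_moments [IsProbabilityMeasure P] (hβ : 0 < β)
    (e : OrthonormalBasis (Fin d) ℝ (E d)) {V₀ : Ω → E d} (hm : Measurable V₀)
    (hV₀ : (∀ᵐ ω ∂P, V₀ ω = 0) ∨
      HasLaw V₀ (multivariateGaussian 0 (β⁻¹ • (1 : Matrix (Fin d) (Fin d) ℝ))) P) (i : Fin d) :
    MemLp (fun ω => inner ℝ (e i) (V₀ ω)) 2 P ∧ ∫ ω, inner ℝ (e i) (V₀ ω) ∂P = 0 ∧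
      ∫ ω, inner ℝ (e i) (V₀ ω) ^ 2 ∂P ≤ β⁻¹ := by
  rcases hV₀ with h | h
  · have h0 : (fun ω => inner ℝ (e i) (V₀ ω)) =ᵐ[P] fun _ => (0 : ℝ) := by
      filter_upwards [h] with ω hω
      simp [hω]
    refine ⟨(memLp_const 0).ae_eq h0.symm, ?_, ?_⟩
    · rw [integral_congr_ae h0]; simp
    · have h1 : (fun ω => inner ℝ (e i) (V₀ ω) ^ 2) =ᵐ[P] fun _ => (0 : ℝ) := by
        filter_upwards [h] with ω hω
        simp [hω]
      rw [integral_congr_ae h1]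
      simpa using hβ.le
  · have hν := hasGaussianCoords_multivariateGaussian e hβ
    have hb : 0 ≤ β⁻¹ := by positivity
    have h1 := hν.memLp_inner i hb
    have h2 := hν.integral_inner i hb
    have h3 := hν.integral_inner_sub_sq i hb 0
    rw [← h.map_eq] at h1 h2 h3
    rw [integral_map (by fun_prop) (by fun_prop)] at h2 h3
    refine ⟨h1.comp_of_map (by fun_prop), h2, ?_⟩
    simpa using h3.le

lemma integral_inner_sub_sq_prod [IsProbabilityMeasure P] {e : OrthonormalBasis (Fin d) ℝ (E d)}
    {v : Fin d → ℝ} {ν : Measure (E d)} [IsProbabilityMeasure ν] {i : Fin d}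
    (hν : HasGaussianCoords e (fun _ => 0) v ν) (hv : 0 ≤ v i) {Y : Ω → ℝ} (hY : MemLp Y 2 P) :
    ∫ y, (inner ℝ (e i) y.2 - Y y.1) ^ 2 ∂(P.prod ν) = v i + ∫ ω, Y ω ^ 2 ∂P := by
  have h1 : MemLp (fun y : Ω × E d => inner ℝ (e i) y.2) 2 (P.prod ν) :=
    (hν.memLp_inner i hv).comp_measurePreserving measurePreserving_snd
  have h2 : MemLp (fun y : Ω × E d => Y y.1) 2 (P.prod ν) :=
    hY.comp_measurePreserving measurePreserving_fst
  have h3 : ∫ y : Ω × E d, Y y.1 * inner ℝ (e i) y.2 ∂(P.prod ν) = 0 := by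
    rw [integral_prod_mul (f := Y) (g := fun y => inner ℝ (e i) y), hν.integral_inner i hv,
      mul_zero]
  have h4 : ∫ y : Ω × E d, inner ℝ (e i) y.2 ^ 2 ∂(P.prod ν) = v i := by
    rw [integral_fun_snd (f := fun y : E d => inner ℝ (e i) y ^ 2)]
    simpa using hν.integral_inner_sub_sq i hv 0
  have h5 : ∫ y : Ω × E d, Y y.1 ^ 2 ∂(P.prod ν) = ∫ ω, Y ω ^ 2 ∂P := by
    rw [integral_fun_fst (f := fun y => Y y ^ 2)]
    simp
  have h6 : Integrable (fun y : Ω × E d => Y y.1 * inner ℝ (e i) y.2) (P.prod ν) :=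
    h2.integrable_mul h1
  calc _ = ∫ y : Ω × E d, (inner ℝ (e i) y.2 ^ 2 + Y y.1 ^ 2 - 2 * (Y y.1 * inner ℝ (e i) y.2))
        ∂(P.prod ν) := by congr 1 with y; ring
    _ = _ := by
        have h7 : Integrable (fun y : Ω × E d => inner ℝ (e i) y.2 ^ 2 + Y y.1 ^ 2) (P.prod ν) :=
          h1.integrable_sq.add h2.integrable_sq
        rw [integral_sub h7 (h6.const_mul 2),
          integral_add h1.integrable_sq h2.integrable_sq, integral_const_mul, h3, h4, h5]
        ring

/-- Contraction estimate: the distance to the invariant law contracts by any factor that controls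
the impulse responses of all eigendirections. -/
lemma IsUnderdampedLangevin.W2_le [IsProbabilityMeasure P] (hH : H.PosDef) (hγ : 0 < γ)
    (hβ : 0 < β) (hVX : IsUnderdampedLangevin (quadObjective H b₁ c₁) γ β P B V X)
    (hg : ∀ i, IsImpulseResponse γ (hH.isHermitian.eigenvalues i) (g i) (g' i)) {x₀ : E d}
    (hX₀ : ∀ᵐ ω ∂P, X 0 ω = x₀)
    (hV₀ : (∀ᵐ ω ∂P, V 0 ω = 0) ∨
      HasLaw (V 0) (multivariateGaussian 0 (β⁻¹ • (1 : Matrix (Fin d) (Fin d) ℝ))) P)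
    (t : ℝ≥0) {K : ℝ} (hK : 0 ≤ K)
    (hgK : ∀ i, (g' i t + γ * g i t) ^ 2 + 2 * hH.isHermitian.eigenvalues i * g i t ^ 2 ≤ K ^ 2) :
    W2 (P.map (X t)) (gibbs β (quadObjective H b₁ c₁)) ≤
      ENNReal.ofReal K * W2 (P.map (X 0)) (gibbs β (quadObjective H b₁ c₁)) := by
  have hprob := isProbabilityMeasure_gibbs hH b₁ c₁ hβ
  have hπ := hasGaussianCoords_gibbs hH b₁ c₁ hβ
  have hν := hasGaussianCoords_multivariateGaussian hH.isHermitian.eigenvectorBasis hβ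
  have hl0 : ∀ i, 0 < hH.isHermitian.eigenvalues i := hH.eigenvalues_pos
  have hsync := hVX.map_synchronous hH hγ hβ hg hX₀ t
  have hvel := initial_velocity_moments hβ hH.isHermitian.eigenvectorBasis (hVX.measurable_V 0) hV₀
  have hm := measurable_synchronous (γ := γ) (g := g) (g' := g')
    hH.isHermitian.eigenvectorBasis (hVX.measurable_V 0) hVX.measurable_X x₀ t
  set e := hH.isHermitian.eigenvectorBasis
  set l := hH.isHermitian.eigenvalues
  set π := gibbs β (quadObjective H b₁ c₁)
  set ν := multivariateGaussian 0 (β⁻¹ • (1 : Matrix (Fin d) (Fin d) ℝ))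
  have hv : ∀ i, 0 ≤ (β * l i)⁻¹ := fun i => by have := hl0 i; positivity
  have hb : 0 ≤ β⁻¹ := by positivity
  have hX0 : P.map (X 0) = Measure.dirac x₀ := by
    rw [Measure.map_congr hX₀]
    simp
  have hXt : P.map (X t) = ((P.prod ν).prod π).map fun z => X t z.1.1 := by
    have hXm := hVX.measurable_X t
    rw [show (fun z : (Ω × E d) × E d => X t z.1.1) = X t ∘ Prod.fst ∘ Prod.fst from rfl,
      ← Measure.map_map hXm (by fun_prop), ← Measure.map_map (by fun_prop) (by fun_prop)]
    simp
  have hcoord : ∀ i z, inner ℝ (e i) (X t z.1.1 - synchronous e γ g g' V X x₀ t z) =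
      -((g' i t + γ * g i t) * (inner ℝ (e i) z.2 - inner ℝ (e i) x₀) +
        g i t * (inner ℝ (e i) z.1.2 - inner ℝ (e i) (V 0 z.1.1))) := fun i z => by
    rw [synchronous, sub_add_cancel_left, inner_neg_right, e.orthonormal.inner_right_fintype,
      inner_sub_right, inner_sub_right]
  have hp : ∀ i, MemLp (fun z : (Ω × E d) × E d => inner ℝ (e i) z.2 - inner ℝ (e i) x₀) 2
      ((P.prod ν).prod π) := fun i =>
    ((hπ.memLp_inner i (hv i)).comp_measurePreserving measurePreserving_snd).sub (memLp_const _)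
  have hq' : ∀ i, MemLp (fun y : Ω × E d => inner ℝ (e i) y.2 - inner ℝ (e i) (V 0 y.1)) 2
      (P.prod ν) := fun i =>
    ((hν.memLp_inner i hb).comp_measurePreserving measurePreserving_snd).sub
      ((hvel i).1.comp_measurePreserving measurePreserving_fst)
  have hq : ∀ i, MemLp (fun z : (Ω × E d) × E d =>
      inner ℝ (e i) z.1.2 - inner ℝ (e i) (V 0 z.1.1)) 2 ((P.prod ν).prod π) := fun i =>
    (hq' i).comp_measurePreserving measurePreserving_fst
  have hcost : ∀ i, ∫ z, inner ℝ (e i) (X t z.1.1 - synchronous e γ g g' V X x₀ t z) ^ 2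
      ∂((P.prod ν).prod π) ≤
      K ^ 2 * ((β * l i)⁻¹ + (inner ℝ (e i) b₁ / l i - inner ℝ (e i) x₀) ^ 2) := fun i => by
    set A := g' i t + γ * g i t
    set p : (Ω × E d) × E d → ℝ := fun z => inner ℝ (e i) z.2 - inner ℝ (e i) x₀
    set q : (Ω × E d) × E d → ℝ := fun z => inner ℝ (e i) z.1.2 - inner ℝ (e i) (V 0 z.1.1)
    have hpp : ∫ z, p z ^ 2 ∂((P.prod ν).prod π) =
        (β * l i)⁻¹ + (inner ℝ (e i) b₁ / l i - inner ℝ (e i) x₀) ^ 2 := by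
      rw [integral_fun_snd (f := fun x : E d => (inner ℝ (e i) x - inner ℝ (e i) x₀) ^ 2),
        hπ.integral_inner_sub_sq i (hv i)]
      simp
    have hqq : ∫ z, q z ^ 2 ∂((P.prod ν).prod π) ≤ 2 * β⁻¹ := by
      rw [integral_fun_fst (f := fun y : Ω × E d =>
          (inner ℝ (e i) y.2 - inner ℝ (e i) (V 0 y.1)) ^ 2),
        integral_inner_sub_sq_prod (P := P) (Y := fun ω => inner ℝ (e i) (V 0 ω)) hν hb
          (hvel i).1]
      simp only [probReal_univ, one_smul]
      linarith [(hvel i).2.2]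
    have hsnd : MemLp (fun y : Ω × E d => inner ℝ (e i) y.2) 2 (P.prod ν) :=
      (hν.memLp_inner i hb).comp_measurePreserving measurePreserving_snd
    have hfst : MemLp (fun y : Ω × E d => inner ℝ (e i) (V 0 y.1)) 2 (P.prod ν) :=
      (hvel i).1.comp_measurePreserving measurePreserving_fst
    -- `p` need not be centred; independence and the zero mean of `q` are enough.
    have hqp : ∫ z, q z * p z ∂((P.prod ν).prod π) = 0 := by
      rw [integral_prod_mul (f := fun y : Ω × E d =>
          inner ℝ (e i) y.2 - inner ℝ (e i) (V 0 y.1))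
          (g := fun x : E d => inner ℝ (e i) x - inner ℝ (e i) x₀),
        integral_sub (hsnd.integrable (by norm_num)) (hfst.integrable (by norm_num)),
        integral_fun_snd (f := fun y : E d => inner ℝ (e i) y),
        integral_fun_fst (f := fun ω => inner ℝ (e i) (V 0 ω)), hν.integral_inner i hb,
        (hvel i).2.1]
      simp
    have hqpi : Integrable (fun z => q z * p z) ((P.prod ν).prod π) := (hq i).integrable_mul (hp i)
    calc _ = ∫ z, (A ^ 2 * p z ^ 2 + g i t ^ 2 * q z ^ 2 + 2 * A * g i t * (q z * p z))
          ∂((P.prod ν).prod π) := by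
          congr 1 with z
          rw [hcoord]
          ring
      _ = A ^ 2 * ((β * l i)⁻¹ + (inner ℝ (e i) b₁ / l i - inner ℝ (e i) x₀) ^ 2) +
          g i t ^ 2 * ∫ z, q z ^ 2 ∂((P.prod ν).prod π) := by
          have hp2 : Integrable (fun z => A ^ 2 * p z ^ 2) ((P.prod ν).prod π) :=
            (hp i).integrable_sq.const_mul _
          have hq2 : Integrable (fun z => g i t ^ 2 * q z ^ 2) ((P.prod ν).prod π) :=
            (hq i).integrable_sq.const_mul _
          have hpq : Integrable (fun z => A ^ 2 * p z ^ 2 + g i t ^ 2 * q z ^ 2)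
            ((P.prod ν).prod π) := hp2.add hq2
          rw [integral_add hpq (hqpi.const_mul _), integral_add hp2 hq2,
            integral_const_mul, integral_const_mul, integral_const_mul, hqp, hpp]
          ring
      _ ≤ A ^ 2 * ((β * l i)⁻¹ + (inner ℝ (e i) b₁ / l i - inner ℝ (e i) x₀) ^ 2) +
          2 * l i * g i t ^ 2 *
            ((β * l i)⁻¹ + (inner ℝ (e i) b₁ / l i - inner ℝ (e i) x₀) ^ 2) := by
          -- Velocity variance is traded for `l` times position variance. The squared mean
          -- displacement may then be added for free, which produces the factor `2 l g²`.
          have h1 : β⁻¹ = l i * (β * l i)⁻¹ := by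
            have := (hl0 i).ne'
            field_simp
          have h2 : 0 ≤ 2 * l i * g i t ^ 2 * (inner ℝ (e i) b₁ / l i - inner ℝ (e i) x₀) ^ 2 := by
            have := hl0 i
            positivity
          have h3 := mul_le_mul_of_nonneg_left hqq (sq_nonneg (g i t))
          rw [h1] at h3
          linarith
      _ ≤ _ := by
          rw [← add_mul]
          exact mul_le_mul_of_nonneg_right (hgK i) (add_nonneg (hv i) (sq_nonneg _))
  have hXm := hVX.measurable_X t
  calc W2 (P.map (X t)) π
      = W2 (((P.prod ν).prod π).map fun z => X t z.1.1)
          (((P.prod ν).prod π).map (synchronous e γ g g' V X x₀ t)) := by rw [hsync, hXt]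
    _ ≤ (∫⁻ z, ‖X t z.1.1 - synchronous e γ g g' V X x₀ t z‖ₑ ^ 2 ∂((P.prod ν).prod π)) ^
          (1 / 2 : ℝ) := W2_map_le _ (by fun_prop) hm
    _ ≤ (ENNReal.ofReal (K ^ 2 * ∑ i, ((β * l i)⁻¹ +
          (inner ℝ (e i) b₁ / l i - inner ℝ (e i) x₀) ^ 2))) ^ (1 / 2 : ℝ) := by
        rw [lintegral_enorm_sq_eq_sum e, Finset.mul_sum]
        · gcongr with i
          exact hcost i
        · intro i
          simp_rw [hcoord]
          exact (((hp i).const_mul _).add ((hq i).const_mul _)).neg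
    _ = _ := by
        rw [hX0, W2_dirac_left, hπ.lintegral_enorm_sub_sq hv, ENNReal.ofReal_mul (sq_nonneg K),
          ENNReal.mul_rpow_of_nonneg _ _ (by norm_num), ENNReal.ofReal_rpow_of_nonneg (sq_nonneg K)
          (by norm_num), ← Real.sqrt_eq_rpow, Real.sqrt_sq hK]

end Coupling

/-! ### Bounds on the extreme eigenvalues and the constants -/

section Constants

variable {d : ℕ} {H : Matrix (Fin d) (Fin d) ℝ}

lemma eigMin_le (hH : H.IsHermitian) (i : Fin d) : eigMin hH ≤ hH.eigenvalues i :=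
  ciInf_le (Set.finite_range _).bddBelow i

lemma le_eigMax (hH : H.IsHermitian) (i : Fin d) : hH.eigenvalues i ≤ eigMax hH :=
  le_ciSup (Set.finite_range _).bddAbove i

lemma eigMin_pos [NeZero d] (hH : H.PosDef) : 0 < eigMin hH.isHermitian := by
  obtain ⟨i, hi⟩ := exists_eq_ciInf_of_finite (f := hH.isHermitian.eigenvalues)
  rw [eigMin, ← hi]
  exact hH.eigenvalues_pos i

lemma constH_nonneg (hH : H.IsHermitian) : 0 ≤ constH hH :=
  Real.iSup_nonneg fun i => div_nonneg (sq_nonneg _) (sub_nonneg.2 i.2.le)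

lemma le_constH (hH : H.IsHermitian) {i : Fin d} (hi : eigMin hH < hH.eigenvalues i) :
    (1 + hH.eigenvalues i) ^ 2 / (hH.eigenvalues i - eigMin hH) ≤ constH hH :=
  le_ciSup (f := fun i : {i : Fin d // eigMin hH < hH.eigenvalues i} =>
    (1 + hH.eigenvalues i) ^ 2 / (hH.eigenvalues i - eigMin hH))
    (Set.finite_range _).bddAbove ⟨i, hi⟩

end Constants

/-! ### Explicit rates and the initial distance -/

section Rates

variable {d : ℕ} {H : Matrix (Fin d) (Fin d) ℝ} {b₁ : E d} {c₁ γ β : ℝ}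
  {Ω : Type*} [MeasurableSpace Ω] {P : Measure Ω} [IsProbabilityMeasure P]
  {B V X : ℝ≥0 → Ω → E d}

lemma IsUnderdampedLangevin.W2_le_of_lt [NeZero d] (hH : H.PosDef) (hγ : 0 < γ) (hβ : 0 < β)
    (hVX : IsUnderdampedLangevin (quadObjective H b₁ c₁) γ β P B V X) {x₀ : E d}
    (hX₀ : ∀ᵐ ω ∂P, X 0 ω = x₀)
    (hV₀ : (∀ᵐ ω ∂P, V 0 ω = 0) ∨
      HasLaw (V 0) (multivariateGaussian 0 (β⁻¹ • (1 : Matrix (Fin d) (Fin d) ℝ))) P)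
    (hlt : γ < 2 * √(eigMin hH.isHermitian)) (t : ℝ≥0) :
    W2 (P.map (X t)) (gibbs β (quadObjective H b₁ c₁)) ≤
      ENNReal.ofReal (constEps hH.isHermitian γ *
        Real.exp (-√(eigMin hH.isHermitian) * (1 - epsHat hH.isHermitian γ) * t)) *
      W2 (P.map (X 0)) (gibbs β (quadObjective H b₁ c₁)) := by
  have hm := eigMin_pos hH
  set m := eigMin hH.isHermitian
  set M := eigMax hH.isHermitian
  set l := hH.isHermitian.eigenvalues
  have hml : ∀ i, m ≤ l i := eigMin_le hH.isHermitian
  have hlM : ∀ i, l i ≤ M := le_eigMax hH.isHermitian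
  have hs : 0 < √m := Real.sqrt_pos.2 hm
  have hss : √m ^ 2 = m := Real.sq_sqrt hm.le
  have hγm : γ ^ 2 / 4 < m := by nlinarith
  have heps : 1 - epsHat hH.isHermitian γ = γ / (2 * √m) := by rw [epsHat]; ring
  have hrate : -√m * (1 - epsHat hH.isHermitian γ) * t = -(γ / 2) * t := by
    rw [heps]; field_simp
  have hden : m * (1 - (1 - epsHat hH.isHermitian γ) ^ 2) = m - γ ^ 2 / 4 := by
    rw [heps, div_pow, mul_pow, hss]; field_simp; ring
  choose g g' hg hbound using fun i =>
    exists_isImpulseResponse_of_underdamped (hγm.trans_le (hml i))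
  have hM : 0 < M := hm.trans_le ((hml 0).trans (hlM 0))
  refine hVX.W2_le hH hγ hβ hg hX₀ hV₀ t ?_ fun i => (hbound i t).trans ?_
  · rw [constEps]
    positivity
  · rw [hrate, mul_pow, exp_half_sq, constEps, hden, div_pow, Real.sq_sqrt (by linarith)]
    gcongr ?_ * _
    have h1 := hml i
    have h2 := hlM i
    have h3 : 0 < m - γ ^ 2 / 4 := by linarith
    -- `4 l ≤ (1 + l)² ≤ (1 + M)²` gives the numerator of `C_ε̂`; its denominator is the worst case
    -- `l = m`.
    have h4 : 4 * l i ≤ (1 + M) ^ 2 := by nlinarith [sq_nonneg (1 - l i)]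
    exact div_le_div₀ (sq_nonneg _) h4 h3 (by linarith)

lemma IsUnderdampedLangevin.W2_le_of_eq [NeZero d] (hH : H.PosDef) (hγ : 0 < γ) (hβ : 0 < β)
    (hVX : IsUnderdampedLangevin (quadObjective H b₁ c₁) γ β P B V X) {x₀ : E d}
    (hX₀ : ∀ᵐ ω ∂P, X 0 ω = x₀)
    (hV₀ : (∀ᵐ ω ∂P, V 0 ω = 0) ∨
      HasLaw (V 0) (multivariateGaussian 0 (β⁻¹ • (1 : Matrix (Fin d) (Fin d) ℝ))) P)
    (heq : γ = 2 * √(eigMin hH.isHermitian)) (t : ℝ≥0) :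
    W2 (P.map (X t)) (gibbs β (quadObjective H b₁ c₁)) ≤
      ENNReal.ofReal (√(constH hH.isHermitian + 2 +
          (eigMin hH.isHermitian + 1) ^ 2 * (t : ℝ) ^ 2) *
        Real.exp (-√(eigMin hH.isHermitian) * t)) *
      W2 (P.map (X 0)) (gibbs β (quadObjective H b₁ c₁)) := by
  have hm := eigMin_pos hH
  have hC := constH_nonneg hH.isHermitian
  have hCle := fun i => le_constH hH.isHermitian (i := i)
  set m := eigMin hH.isHermitian
  set l := hH.isHermitian.eigenvalues
  set C := constH hH.isHermitian
  have hml : ∀ i, m ≤ l i := eigMin_le hH.isHermitian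
  have hγm : γ ^ 2 / 4 = m := by rw [heq, mul_pow, Real.sq_sqrt hm.le]; ring
  -- Eigendirections with `l = m` are critically damped and account for `2 + (m + 1)² t²`, through
  -- `4 m ≤ (m + 1)²`; those with `l > m` are underdamped and account for `C_H`. All decay at the
  -- common rate `γ/2 = √m`.
  have hex : ∀ i, ∃ g g' : ℝ → ℝ, IsImpulseResponse γ (l i) g g' ∧
      (g' t + γ * g t) ^ 2 + 2 * l i * g t ^ 2 ≤
        (C + 2 + (m + 1) ^ 2 * (t : ℝ) ^ 2) * Real.exp (-γ * t) := fun i => by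
    rcases (hml i).eq_or_lt with h | h
    · obtain ⟨g, g', hg, hb⟩ := exists_isImpulseResponse_of_critical (h.symm.trans hγm.symm)
      refine ⟨g, g', hg, (hb t).trans ?_⟩
      gcongr ?_ * _
      have : 4 * l i * (t : ℝ) ^ 2 ≤ (m + 1) ^ 2 * (t : ℝ) ^ 2 := by
        gcongr
        rw [← h]
        nlinarith [sq_nonneg (m - 1)]
      linarith
    · obtain ⟨g, g', hg, hb⟩ := exists_isImpulseResponse_of_underdamped (hγm.trans_lt h)
      refine ⟨g, g', hg, (hb t).trans ?_⟩
      gcongr ?_ * _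
      rw [hγm]
      have h1 : 4 * l i / (l i - m) ≤ (1 + l i) ^ 2 / (l i - m) :=
        div_le_div_of_nonneg_right (by nlinarith [sq_nonneg (1 - l i)]) (sub_nonneg.2 h.le)
      have h2 := hCle i h
      have h3 : 0 ≤ (m + 1) ^ 2 * (t : ℝ) ^ 2 := by positivity
      linarith
  choose g g' hg hbound using hex
  refine hVX.W2_le hH hγ hβ hg hX₀ hV₀ t (by positivity) fun i => (hbound i).trans_eq ?_
  rw [mul_pow, Real.sq_sqrt (by positivity), show -√m = -(γ / 2) by rw [heq]; ring, exp_half_sq]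

lemma W2_dirac_gibbs_le [NeZero d] (hH : H.PosDef) (hβ : 0 < β) (x₀ : E d) :
    W2 (Measure.dirac x₀) (gibbs β (quadObjective H b₁ c₁)) ≤
      ENNReal.ofReal (√(2 * ‖x₀‖ ^ 2 + 4 / eigMin hH.isHermitian *
        (‖b₁‖ ^ 2 / (2 * eigMin hH.isHermitian) + d / β))) := by
  have hm := eigMin_pos hH
  have hprob := isProbabilityMeasure_gibbs hH b₁ c₁ hβ
  have hl0 := hH.eigenvalues_pos
  rw [W2_dirac_left, (hasGaussianCoords_gibbs hH b₁ c₁ hβ).lintegral_enorm_sub_sq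
    (fun i => by have := hl0 i; positivity), ENNReal.ofReal_rpow_of_nonneg
    (Finset.sum_nonneg fun i _ => by have := hl0 i; positivity) (by norm_num),
    ← Real.sqrt_eq_rpow]
  refine ENNReal.ofReal_le_ofReal (Real.sqrt_le_sqrt ?_)
  have hml := eigMin_le hH.isHermitian
  set m := eigMin hH.isHermitian
  set l := hH.isHermitian.eigenvalues
  set e := hH.isHermitian.eigenvectorBasis
  -- Each mean displacement is bounded by `(u - v)² ≤ 2 u² + 2 v²`, and every `l i` by `m` from
  -- below. The dimension term has room to spare: `d/(β m)` against `4 d/(β m)`.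
  calc _ ≤ ∑ i, ((β * m)⁻¹ + (2 * (inner ℝ (e i) b₁ ^ 2 / m ^ 2) + 2 * inner ℝ (e i) x₀ ^ 2)) := by
        refine Finset.sum_le_sum fun i _ => add_le_add ?_ ?_
        · have := hml i
          gcongr
        · have h1 : (inner ℝ (e i) b₁ / l i) ^ 2 ≤ inner ℝ (e i) b₁ ^ 2 / m ^ 2 := by
            rw [div_pow]
            have := hml i
            gcongr
          nlinarith [sq_nonneg (inner ℝ (e i) b₁ / l i + inner ℝ (e i) x₀)]
    _ = d * (β * m)⁻¹ + (2 * (‖b₁‖ ^ 2 / m ^ 2) + 2 * ‖x₀‖ ^ 2) := by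
        rw [Finset.sum_add_distrib, Finset.sum_add_distrib, ← Finset.mul_sum, ← Finset.mul_sum,
          ← Finset.sum_div, e.sum_sq_inner_right, e.sum_sq_inner_right]
        simp
    _ ≤ _ := by
        have h1 : 4 / m * (‖b₁‖ ^ 2 / (2 * m) + d / β) =
            2 * (‖b₁‖ ^ 2 / m ^ 2) + 4 * (d * (β * m)⁻¹) := by
          field_simp
          ring
        have h2 : 0 ≤ (d : ℝ) * (β * m)⁻¹ := by positivity
        rw [h1]
        linarith

end Rates

end ULD

theorem theorem1 {d : ℕ} [NeZero d]
    (H : Matrix (Fin d) (Fin d) ℝ) (hH : H.PosDef) (b₁ : ULD.E d) (c₁ : ℝ)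
    (γ β : ℝ) (hγ : 0 < γ) (hβ : 0 < β)
    {Ω : Type*} [MeasurableSpace Ω] (P : Measure Ω) [IsProbabilityMeasure P]
    (B V X : ℝ≥0 → Ω → ULD.E d)
    (hVX : ULD.IsUnderdampedLangevin (ULD.quadObjective H b₁ c₁) γ β P B V X)
    (x₀ : ULD.E d) (hX₀ : ∀ᵐ ω ∂P, X 0 ω = x₀)
    (hV₀ : (∀ᵐ ω ∂P, V 0 ω = 0) ∨
      HasLaw (V 0) (multivariateGaussian 0 (β⁻¹ • (1 : Matrix (Fin d) (Fin d) ℝ))) P) :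
    (γ < 2 * √(ULD.eigMin hH.isHermitian) → ∀ t : ℝ≥0,
      ULD.W2 (P.map (X t)) (ULD.gibbs β (ULD.quadObjective H b₁ c₁)) ≤
        ENNReal.ofReal (ULD.constEps hH.isHermitian γ *
          Real.exp (-√(ULD.eigMin hH.isHermitian) * (1 - ULD.epsHat hH.isHermitian γ) * t)) *
        ULD.W2 (P.map (X 0)) (ULD.gibbs β (ULD.quadObjective H b₁ c₁))) ∧
    (γ = 2 * √(ULD.eigMin hH.isHermitian) → ∀ t : ℝ≥0,
      ULD.W2 (P.map (X t)) (ULD.gibbs β (ULD.quadObjective H b₁ c₁)) ≤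
        ENNReal.ofReal (√(ULD.constH hH.isHermitian + 2 +
            (ULD.eigMin hH.isHermitian + 1) ^ 2 * (t : ℝ) ^ 2) *
          Real.exp (-√(ULD.eigMin hH.isHermitian) * t)) *
        ULD.W2 (P.map (X 0)) (ULD.gibbs β (ULD.quadObjective H b₁ c₁))) ∧
    ULD.W2 (P.map (X 0)) (ULD.gibbs β (ULD.quadObjective H b₁ c₁)) ≤
      ENNReal.ofReal (√(2 * ‖x₀‖ ^ 2 + 4 / ULD.eigMin hH.isHermitian *
        (‖b₁‖ ^ 2 / (2 * ULD.eigMin hH.isHermitian) + d / β))) := by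
  refine ⟨hVX.W2_le_of_lt hH hγ hβ hX₀ hV₀, hVX.W2_le_of_eq hH hγ hβ hX₀ hV₀, ?_⟩
  rw [Measure.map_congr hX₀, Measure.map_const, measure_univ, one_smul]
  exact ULD.W2_dirac_gibbs_le hH hβ x₀
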